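/- Let $L\ge 0$, $K\ge 0$, let $a_0<a_1<\dots<a_{2^L}$ be real numbers, and let $m_1,\dots,m_K$ be nonnegative integers. Given hyper-parameters $\alpha_{l,j},\beta_{l,j}>0$ ($1\le l\le L$, $1\le j\le 2^{l-1}$), the hierarchical finite Polya tree model is as follows. * The variables $\phi_{l,j}\sim \mathrm{Beta}(\alpha_{l,j},\beta_{l,j})$ are independent. Put $\pi_{0,1}=1$ and, for $1\le l\le L$ and $1\le j\le 2^{l-1}$, $\pi_{l,2j-1}=\phi_{l,j}\,\pi_{l-1,j}$ and $\pi_{l,2j}=(1-\phi_{l,j})\,\pi_{l-1,j}$. Write $\vec\pi_L=(\pi_{L,1},\dots,\pi_{L,2^L})$. * Given $\vec\pi_L$, the variables $\theta_1,\dots,\theta_K$ are independent with the step function density $f(t\mid\vec\pi_L;\vec a)=\sum_{i=1}^{2^L}\pi_{L,i}\,\mathbf 1_{(a_{i-1},a_i]}(t)/(a_i-a_{i-1})$. * Given $\vec\pi_L$ and $\vec\theta$, the variables $X_1,\dots,X_K$ are independent with $X_k\sim \mathrm{Binomial}(m_k,\,e^{\theta_k}/(1+e^{\theta_k}))$. Let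 $\mathrm{CDF}_{\vec\pi_L}(x)=\int_{-\infty}^x f(t\mid\vec\pi_L;\vec a)\,dt$, so that $\mathrm{CDF}_{\vec\pi_L}(a_j)=\pi_{L,1}+\dots+\pi_{L,j}$. For distributions on $\mathbb R$, say that $\mu$ is stochastically smaller than $\nu$ if $\mu((x,\infty))\le\nu((x,\infty))$ for all $x\in\mathbb R$. Say that the conditional distribution of $\mathrm{CDF}_{\vec\pi_L}(a_j)$ given $\vec\theta$ is stochastically decreasing in $\vec\theta$ if there is a version $\kappa$ of the regular conditional distribution of $\mathrm{CDF}_{\vec\pi_L}(a_j)$ given $\vec\theta$ such that, for all $s,t\in(a_0,a_{2^L}]^K$ with $s_k\le t_k$ for every $k$, $\kappa(t,\cdot)$ is stochastically smaller than $\kappa(s,\cdot)$. 1. If $\alpha_{l,j}=\beta_{l,j}=1$ for all $l,j$, then for every $j\in\{0,\dots,2^L\}$ the conditional distribution of $\mathrm{CDF}_{\vec\pi_L}(a_j)$ given $\vec\theta$ is stochastically decreasing in $\vec\theta$. 2. This can fail for other hyper-parameters: for $L=2$, $K=1$, $\phi_{1,1}\sim\mathrm{Beta}(10^6,10^6)$,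 $\phi_{2,1},\phi_{2,2}\sim\mathrm{Beta}(1,1)$ (and any $\vec a$, $m_1$), the conditional distribution of $\mathrm{CDF}_{\vec\pi_2}(a_1)$ given $\theta_1$ is not stochastically decreasing in $\theta_1$. -/

import Mathlib

open MeasureTheory ProbabilityTheory

noncomputable section

namespace FinitePolyaTree

/-- The splits of an `L`-level dyadic tree: the pair `(l, i)` (zero-based) is the split of the
`i`-th of the `2 ^ l` subintervals of level `l` into its left and right halves, which are
subintervals `2 * i` and `2 * i + 1` of level `l + 1`.  In one-based notation this is the split
carrying the variable `φ_{l+1, i+1}`, where `l + 1 = 1, …, L` and `i + 1 = 1, …, 2 ^ l`. -/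
abbrev Split (L : ℕ) : Type := (l : Fin L) × Fin (2 ^ (l : ℕ))

/-- Subinterval probabilities: `intervalProb φ l hl i` (zero-based `i`) is `π_{l, i+1}`, that is
`π_0 = 1`, `π_{l+1, 2j-1} = φ_{l+1, j} * π_{l, j}` and
`π_{l+1, 2j} = (1 - φ_{l+1, j}) * π_{l, j}`. -/
def intervalProb {L : ℕ} (φ : Split L → ℝ) : (l : ℕ) → l ≤ L → Fin (2 ^ l) → ℝ
  | 0, _, _ => 1
  | l + 1, hl, i =>
      let parent : Fin (2 ^ l) := ⟨(i : ℕ) / 2, Nat.div_lt_of_lt_mul (by have := i.isLt; omega)⟩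
      (if (i : ℕ) % 2 = 0 then φ ⟨⟨l, hl⟩, parent⟩ else 1 - φ ⟨⟨l, hl⟩, parent⟩) *
        intervalProb φ l (Nat.le_of_succ_le hl) parent

/-- The vector `π_L = (π_{L,1}, …, π_{L,2^L})` of leaf probabilities. -/
def leafProb {L : ℕ} (φ : Split L → ℝ) : Fin (2 ^ L) → ℝ :=
  intervalProb φ L le_rfl

lemma measurable_intervalProb {L : ℕ} (l : ℕ) (hl : l ≤ L) (i : Fin (2 ^ l)) :
    Measurable fun φ : Split L → ℝ => intervalProb φ l hl i := by
  induction l with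
  | zero => exact measurable_const
  | succ l ih =>
    simp only [intervalProb]
    refine Measurable.mul ?_ (ih _ _)
    split_ifs
    · exact measurable_pi_apply _
    · exact measurable_const.sub (measurable_pi_apply _)

lemma measurable_leafProb (L : ℕ) : Measurable (leafProb (L := L)) :=
  measurable_pi_lambda _ fun i => measurable_intervalProb L le_rfl i

/-- The law of `π_L` in the finite Polya tree model with hyper-parameters `(α, β)`: the split
variables `φ_{l,j} ∼ Beta(α_{l,j}, β_{l,j})` are independent. -/
def fptLaw {L : ℕ} (α β : Split L → ℝ) : Measure (Fin (2 ^ L) → ℝ) :=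
  (Measure.pi fun s => betaMeasure (α s) (β s)).map leafProb

/-- The step function density `f(t | p; a) = ∑_i p_i I_{(a_{i-1}, a_i]}(t) / (a_i - a_{i-1})`. -/
def stepDensity {L : ℕ} (a : Fin (2 ^ L + 1) → ℝ) (p : Fin (2 ^ L) → ℝ) (t : ℝ) : ℝ :=
  ∑ i : Fin (2 ^ L),
    p i * (Set.Ioc (a i.castSucc) (a i.succ)).indicator
      (fun _ => 1 / (a i.succ - a i.castSucc)) t

/-- The cumulative distribution function of the distribution with density `f(· | p; a)`. -/
def mixingCDF {L : ℕ} (a : Fin (2 ^ L + 1) → ℝ) (p : Fin (2 ^ L) → ℝ) (x : ℝ) : ℝ :=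
  ∫ t in Set.Iic x, stepDensity a p t

/-- At the endpoint `a_j` the CDF is `p_1 + … + p_j`. -/
lemma mixingCDF_apply_endpoint {L : ℕ} (a : Fin (2 ^ L + 1) → ℝ) (ha : StrictMono a)
    (p : Fin (2 ^ L) → ℝ) (j : Fin (2 ^ L + 1)) :
    mixingCDF a p (a j) = ∑ i : Fin (2 ^ L), if (i : ℕ) < j then p i else 0 := by
  have hint : ∀ i : Fin (2 ^ L), Integrable
      (fun t => p i * (Set.Ioc (a i.castSucc) (a i.succ)).indicator
        (fun _ => 1 / (a i.succ - a i.castSucc)) t) (volume.restrict (Set.Iic (a j))) := by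
    intro i
    refine Integrable.const_mul (Integrable.restrict ?_) _
    refine (integrable_indicator_iff measurableSet_Ioc).2 ?_
    exact integrableOn_const (by simp)
  unfold mixingCDF stepDensity
  rw [integral_finsetSum _ fun i _ => hint i]
  refine Finset.sum_congr rfl fun i _ => ?_
  rw [integral_const_mul, setIntegral_indicator measurableSet_Ioc, setIntegral_const]
  have hpos : 0 < a i.succ - a i.castSucc := sub_pos.2 (ha i.castSucc_lt_succ)
  split_ifs with h
  · have h1 : a i.succ ≤ a j := ha.monotone (by rw [Fin.le_def, Fin.val_succ]; omega)
    have : Set.Iic (a j) ∩ Set.Ioc (a i.castSucc) (a i.succ) =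
        Set.Ioc (a i.castSucc) (a i.succ) :=
      Set.inter_eq_right.2 fun t ht => ht.2.trans h1
    rw [this, Real.volume_real_Ioc_of_le (by linarith), smul_eq_mul, mul_one_div_cancel hpos.ne',
      mul_one]
  · have h1 : a j ≤ a i.castSucc := ha.monotone (by rw [Fin.le_def, Fin.val_castSucc]; omega)
    have : Set.Iic (a j) ∩ Set.Ioc (a i.castSucc) (a i.succ) = ∅ := by
      ext t
      simp only [Set.mem_inter_iff, Set.mem_Iic, Set.mem_Ioc, Set.mem_empty_iff_false, iff_false]
      rintro ⟨h2, h3, -⟩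
      linarith
    simp [this]

/-- The joint law of `(π_L, θ, X)` in the hierarchical model: `π_L` is drawn from the finite Polya
tree model with hyper-parameters `(α, β)`; given `π_L`, the `θ_k` are independent with density
`f(· | π_L; a)`; given `(π_L, θ)`, the `X_k` are independent `Binomial(m_k, logit⁻¹ θ_k)`.
It is given by its joint density with respect to the law of `π_L`, Lebesgue measure for `θ` and
counting measure for `X`. -/
def generativeModel {L K : ℕ} (a : Fin (2 ^ L + 1) → ℝ) (α β : Split L → ℝ) (m : Fin K → ℕ) :
    Measure ((Fin (2 ^ L) → ℝ) × (Fin K → ℝ) × (Fin K → ℕ)) :=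
  ((fptLaw α β).prod
    ((volume : Measure (Fin K → ℝ)).prod (Measure.count : Measure (Fin K → ℕ)))).withDensity
    fun z => ∏ k, ENNReal.ofReal (stepDensity a z.1 (z.2.1 k)) *
      binomial (m k) (unitInterval.sigmoid (z.2.1 k)) {z.2.2 k}

/-- The usual stochastic order on distributions on the real line: `μ` is stochastically smaller
than `ν`. -/
def StochLE (μ ν : Measure ℝ) : Prop :=
  ∀ x : ℝ, μ (Set.Ioi x) ≤ ν (Set.Ioi x)

/-- The conditional distribution of the real random variable `Y` given the random vector `θ` is
stochastically decreasing in `θ` over the region `S`: there is a version `κ` of the regular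
conditional distribution of `Y` given `θ` such that increasing (some of) the components of the
conditioning value, inside `S`, makes the conditional distribution stochastically smaller. -/
def CondStochDecreasing {Ω : Type*} [MeasurableSpace Ω] {K : ℕ} (P : Measure Ω) (Y : Ω → ℝ)
    (θ : Ω → Fin K → ℝ) (S : Set (Fin K → ℝ)) : Prop :=
  ∃ κ : Kernel (Fin K → ℝ) ℝ, IsMarkovKernel κ ∧ HasCondDistrib Y θ κ P ∧
    ∀ s ∈ S, ∀ t ∈ S, s ≤ t → StochLE (κ t) (κ s)

/-- The vectors all of whose components lie in `(a_0, a_{2^L}]`, the union of the leaf intervals. -/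
def thetaRange {L : ℕ} (K : ℕ) (a : Fin (2 ^ L + 1) → ℝ) : Set (Fin K → ℝ) :=
  {t | ∀ k, t k ∈ Set.Ioc (a 0) (a (Fin.last (2 ^ L)))}

end FinitePolyaTree

end

/-!
A finite Polya tree with Beta splits is conjugate to its step function density: given `θ`, the
splits are again independent, and the two parameters of a split are increased by the numbers of
the `θ_k` in its left and right children (`lintegral_pi_betaMeasure_leafProb`).  The distribution
function at an endpoint involves only the splits on one path from a leaf to the root
(`sum_leafProb_add`), and along this path it is obtained from the leaf upwards by the affine maps
`y ↦ ψ y` (when the path child is on the left) and `y ↦ 1 - ψ + ψ y` (on the right), with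
independent Beta weights `ψ`.  Under uniform priors its posterior is therefore `pathLaw`, which
depends on `θ` through the numbers of observations in the leaf and in the siblings of the path
nodes.

Increasing a component of `θ` moves one observation to the right.  The effect is not monotone split
by split: an observation leaving the left child of a node for its right child lowers the weight of
the left child, but it also changes the distribution function inside this child, possibly upwards.
For uniform priors the first effect dominates.  Quantitatively, the distribution function `F` of a
node with `N + 1` observations and the one, `F'`, after the deletion of any one of them satisfy
`r F' ≤ F` stochastically, for an independent `r ∼ Beta(N + 1, 1)` (`lintegral_pathLaw_addObs'`),
and the laws `Beta(N + 2, c) ⊗ Beta(N + 1, 1)` and `Beta(N + c + 1, 1) ⊗ Beta(N + 1, c)` are linked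
by a Dirichlet identity (`lintegral_betaMeasure_split`), so that this factor is absorbed exactly by
the change of the Beta weight of the node (`pathLaw_addObs_le_of_left`).  Observations
entering the path node from its left sibling are treated by reflecting the tree
(`pathLaw_addObs_le_of_right`).

For the negative statement, stochastic monotonicity would give
`E[π₁ π₃] E[π₂] ≤ E[π₁ π₂] E[π₃]` (`CondStochDecreasing.leafCell_le`).  With `Beta(A, A)` at the
root and uniform splits below, this reads `A / 4 ≤ (A + 1) / 6` up to a common positive factor,
which fails for `A > 2`.
-/

namespace FinitePolyaTree

open Set
open scoped ENNReal

/-! ### Beta distributions -/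

lemma lintegral_betaMeasure {a b : ℝ} (ha : 0 < a) (hb : 0 < b) {f : ℝ → ℝ≥0∞}
    (hf : Measurable f) :
    ∫⁻ x, f x ∂betaMeasure a b = ENNReal.ofReal (1 / beta a b) *
      ∫⁻ x in Ioo 0 1, ENNReal.ofReal (x ^ (a - 1) * (1 - x) ^ (b - 1)) * f x := by
  have hpdf : Measurable (betaPDF a b) := by unfold betaPDF; fun_prop
  rw [betaMeasure, lintegral_withDensity_eq_lintegral_mul _ hpdf hf,
    ← lintegral_const_mul _ (by fun_prop), ← lintegral_indicator measurableSet_Ioo]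
  refine lintegral_congr fun x => ?_
  by_cases hx : x ∈ Ioo (0 : ℝ) 1
  · rw [indicator_of_mem hx, Pi.mul_apply, betaPDF_of_pos_lt_one hx.1 hx.2, mul_assoc,
      ENNReal.ofReal_mul (one_div_pos.2 (beta_pos ha hb)).le, mul_assoc]
  · rw [indicator_of_notMem hx, Pi.mul_apply, betaPDF_eq, if_neg (by simpa using hx)]
    simp

lemma ae_mem_Ioo_betaMeasure (a b : ℝ) : ∀ᵐ x ∂betaMeasure a b, x ∈ Ioo (0 : ℝ) 1 := by
  have hpdf : Measurable (betaPDF a b) := by unfold betaPDF; fun_prop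
  rw [betaMeasure, ae_withDensity_iff hpdf]
  refine Filter.Eventually.of_forall fun x hx => ?_
  by_contra h
  exact hx (by rw [betaPDF_eq, if_neg (by simpa using h), ENNReal.ofReal_zero])

/-- If the integrals of the functions `u i` and `v i` against two probability measures are fixed
multiples `c` and `d` of a common quantity `I i`, and some `u i` and `v i` are the constant `1`,
then `c = d` and the integrals agree.  This avoids computing normalising constants. -/
lemma lintegral_eq_of_proportional {Ω Ω' ι : Type*} [MeasurableSpace Ω] [MeasurableSpace Ω']
    {μ : Measure Ω} {ν : Measure Ω'} [IsProbabilityMeasure μ] [IsProbabilityMeasure ν]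
    {u : ι → Ω → ℝ≥0∞} {v : ι → Ω' → ℝ≥0∞} {I : ι → ℝ≥0∞} {c d : ℝ≥0∞} {i₀ : ι}
    (hu : u i₀ = fun _ => 1) (hv : v i₀ = fun _ => 1)
    (hd : d ≠ 0) (h₁ : ∀ i, ∫⁻ x, u i x ∂μ = c * I i) (h₂ : ∀ i, ∫⁻ x, v i x ∂ν = d * I i) (i : ι) :
    ∫⁻ x, u i x ∂μ = ∫⁻ x, v i x ∂ν := by
  have e₁ := h₁ i₀
  have e₂ := h₂ i₀
  simp only [hu, hv, lintegral_one, measure_univ] at e₁ e₂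
  have hI : I i₀ ≠ 0 := by
    intro h
    simp [h] at e₂
  have hI' : I i₀ ≠ ∞ := by
    intro h
    rw [h, ENNReal.mul_top hd] at e₂
    exact ENNReal.one_ne_top e₂
  have : c = d := (ENNReal.mul_left_inj hI hI').1 (e₁.symm.trans e₂)
  rw [h₁, h₂, this]

lemma lintegral_betaMeasure_one_sub {a b : ℝ} (ha : 0 < a) (hb : 0 < b) {f : ℝ → ℝ≥0∞}
    (hf : Measurable f) :
    ∫⁻ x, f (1 - x) ∂betaMeasure a b = ∫⁻ x, f x ∂betaMeasure b a := by
  rw [lintegral_betaMeasure ha hb (f := fun x => f (1 - x)) (by fun_prop),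
    lintegral_betaMeasure hb ha hf]
  have hsym : beta a b = beta b a := by
    simp only [beta, mul_comm (Real.Gamma a), add_comm a]
  rw [hsym]
  congr 1
  rw [← lintegral_indicator measurableSet_Ioo, ← lintegral_indicator measurableSet_Ioo,
    ← lintegral_sub_left_eq_self _ (1 : ℝ)]
  refine lintegral_congr fun x => ?_
  by_cases hx : x ∈ Ioo (0 : ℝ) 1
  · have hx' : 1 - x ∈ Ioo (0 : ℝ) 1 := ⟨by linarith [hx.2], by linarith [hx.1]⟩
    rw [indicator_of_mem hx, indicator_of_mem hx', sub_sub_cancel, mul_comm (x ^ _)]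
  · have hx' : 1 - x ∉ Ioo (0 : ℝ) 1 := fun h => hx ⟨by linarith [h.2], by linarith [h.1]⟩
    rw [indicator_of_notMem hx, indicator_of_notMem hx']

/-- Reweighting a Beta law by a Bernoulli likelihood gives a multiple of the conjugate Beta law. -/
lemma lintegral_betaMeasure_conjugate {a b : ℝ} (ha : 0 < a) (hb : 0 < b) (n m : ℕ)
    {f : ℝ → ℝ≥0∞} (hf : Measurable f) :
    ∫⁻ x, ENNReal.ofReal x ^ n * ENNReal.ofReal (1 - x) ^ m * f x ∂betaMeasure a b =
      ENNReal.ofReal (beta (a + n) (b + m) / beta a b) *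
        ∫⁻ x, f x ∂betaMeasure (a + n) (b + m) := by
  have h₁ : 0 < beta a b := beta_pos ha hb
  have h₂ : 0 < beta (a + n) (b + m) := beta_pos (by positivity) (by positivity)
  rw [lintegral_betaMeasure ha hb (by fun_prop),
    lintegral_betaMeasure (by positivity) (by positivity) hf, ← mul_assoc,
    ← ENNReal.ofReal_mul (by positivity)]
  congr 1
  · congr 1
    field_simp
  · refine setLIntegral_congr_fun measurableSet_Ioo fun x hx => ?_
    have hx' : 0 < 1 - x := sub_pos.2 hx.2
    have hx0 : 0 < x := hx.1
    rw [← ENNReal.ofReal_pow hx.1.le, ← ENNReal.ofReal_pow hx'.le, ← mul_assoc,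
      ← ENNReal.ofReal_mul (by positivity), ← ENNReal.ofReal_mul (by positivity)]
    congr 2
    rw [add_sub_right_comm, add_sub_right_comm, Real.rpow_add hx.1, Real.rpow_add hx',
      Real.rpow_natCast, Real.rpow_natCast]
    ring

lemma lintegral_comp_const_mul {R : ℝ} (hR : 0 < R) {G : ℝ → ℝ≥0∞} (hG : Measurable G) :
    ENNReal.ofReal R * ∫⁻ x, G (R * x) = ∫⁻ x, G x := by
  conv_rhs => rw [← Real.smul_map_volume_mul_left hR.ne']
  rw [lintegral_smul_measure, lintegral_map hG (by fun_prop), abs_of_pos hR, smul_eq_mul]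

/-- The substitution `u = R x` in an unnormalised Beta integral. -/
lemma ofReal_rpow_mul_lintegral_scale {R : ℝ} (hR : 0 < R) (a b : ℝ) {G : ℝ → ℝ≥0∞}
    (hG : Measurable G) :
    ENNReal.ofReal (R ^ (a + b - 1)) *
        ∫⁻ x in Ioo 0 1, ENNReal.ofReal (x ^ (a - 1) * (1 - x) ^ (b - 1)) * G (R * x) =
      ∫⁻ u in Ioo 0 R, ENNReal.ofReal (u ^ (a - 1) * (R - u) ^ (b - 1)) * G u := by
  rw [← lintegral_indicator measurableSet_Ioo, ← lintegral_indicator measurableSet_Ioo,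
    ← lintegral_comp_const_mul hR
      (G := (Ioo 0 R).indicator fun u => ENNReal.ofReal (u ^ (a - 1) * (R - u) ^ (b - 1)) * G u)
      (Measurable.indicator (by fun_prop) measurableSet_Ioo),
    ← lintegral_const_mul' _ _ ENNReal.ofReal_ne_top,
    ← lintegral_const_mul' _ _ ENNReal.ofReal_ne_top]
  refine lintegral_congr fun x => ?_
  by_cases hx : x ∈ Ioo (0 : ℝ) 1
  · have hx' : R * x ∈ Ioo 0 R := ⟨mul_pos hR hx.1, by nlinarith [hx.2]⟩
    have h1 : 0 ≤ 1 - x := by linarith [hx.2]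
    rw [indicator_of_mem hx, indicator_of_mem hx', ← mul_assoc, ← mul_assoc,
      ← ENNReal.ofReal_mul (by positivity), ← ENNReal.ofReal_mul hR.le]
    congr 2
    rw [show R - R * x = R * (1 - x) by ring, Real.mul_rpow hR.le hx.1.le,
      Real.mul_rpow hR.le h1, show a + b - 1 = 1 + ((a - 1) + (b - 1)) by ring,
      Real.rpow_add hR, Real.rpow_add hR, Real.rpow_one]
    ring
  · have hx' : R * x ∉ Ioo 0 R := fun h => hx
      ⟨by have := h.1; rwa [mul_pos_iff_of_pos_left hR] at this, by
        have := h.2; nlinarith⟩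
    rw [indicator_of_notMem hx, indicator_of_notMem hx']
    simp

lemma setLIntegral_triangle_swap {K : ℝ → ℝ → ℝ≥0∞} (hK : Measurable (Function.uncurry K)) :
    ∫⁻ r in Ioo (0 : ℝ) 1, ∫⁻ u in Ioo 0 r, K r u =
      ∫⁻ u in Ioo (0 : ℝ) 1, ∫⁻ r in Ioo u 1, K r u := by
  have hS : MeasurableSet {p : ℝ × ℝ | 0 < p.2 ∧ p.2 < p.1 ∧ p.1 < 1} :=
    ((measurableSet_lt measurable_const measurable_snd).inter
      ((measurableSet_lt measurable_snd measurable_fst).inter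
        (measurableSet_lt measurable_fst measurable_const)))
  have hm := hK.indicator hS
  have e₁ : ∀ r u : ℝ, (Ioo (0 : ℝ) 1).indicator (fun r => (Ioo 0 r).indicator (K r) u) r =
      ({p : ℝ × ℝ | 0 < p.2 ∧ p.2 < p.1 ∧ p.1 < 1}.indicator (Function.uncurry K)) (r, u) := by
    intro r u
    simp only [indicator_apply, mem_Ioo, mem_ofPred_eq, Function.uncurry]
    split_ifs <;> grind
  have e₂ : ∀ r u : ℝ, (Ioo (0 : ℝ) 1).indicator (fun u => (Ioo u 1).indicator (K · u) r) u =
      ({p : ℝ × ℝ | 0 < p.2 ∧ p.2 < p.1 ∧ p.1 < 1}.indicator (Function.uncurry K)) (r, u) := by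
    intro r u
    simp only [indicator_apply, mem_Ioo, mem_ofPred_eq, Function.uncurry]
    split_ifs <;> grind
  have l₁ : ∀ r : ℝ, (Ioo (0 : ℝ) 1).indicator (fun r => ∫⁻ u in Ioo 0 r, K r u) r =
      ∫⁻ u, (Ioo (0 : ℝ) 1).indicator (fun r => (Ioo 0 r).indicator (K r) u) r := by
    intro r
    by_cases hr : r ∈ Ioo (0 : ℝ) 1
    · simp only [indicator_of_mem hr, lintegral_indicator measurableSet_Ioo]
    · simp only [indicator_of_notMem hr, lintegral_zero]
  have l₂ : ∀ u : ℝ, (Ioo (0 : ℝ) 1).indicator (fun u => ∫⁻ r in Ioo u 1, K r u) u =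
      ∫⁻ r, (Ioo (0 : ℝ) 1).indicator (fun u => (Ioo u 1).indicator (K · u) r) u := by
    intro u
    by_cases hu : u ∈ Ioo (0 : ℝ) 1
    · simp only [indicator_of_mem hu, lintegral_indicator measurableSet_Ioo]
    · simp only [indicator_of_notMem hu, lintegral_zero]
  rw [← lintegral_indicator measurableSet_Ioo, ← lintegral_indicator measurableSet_Ioo,
    lintegral_congr l₁, lintegral_congr l₂]
  simp_rw [e₁, e₂]
  exact lintegral_lintegral_swap hm.aemeasurable

/-- The joint law of `(R, R p)` for independent `R ∼ Beta(a + b, 1)` and `p ∼ Beta(a, b)`, up to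
a normalising constant, as an iterated integral over the triangle `0 < u < r < 1`. -/
lemma lintegral_betaMeasure_mul_aux {a b : ℝ} (ha : 0 < a) (hb : 0 < b) {H : ℝ → ℝ → ℝ≥0∞}
    (hH : Measurable (Function.uncurry H)) :
    ∫⁻ r, ∫⁻ p, H r (r * p) ∂betaMeasure a b ∂betaMeasure (a + b) 1 =
      ENNReal.ofReal (1 / beta (a + b) 1) * ENNReal.ofReal (1 / beta a b) *
        ∫⁻ u in Ioo (0 : ℝ) 1, ENNReal.ofReal (u ^ (a - 1)) *
          ∫⁻ r in Ioo u 1, ENNReal.ofReal ((r - u) ^ (b - 1)) * H r u := by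
  have := isProbabilityMeasureBeta ha hb
  have hin : Measurable fun r => ∫⁻ p, H r (r * p) ∂betaMeasure a b :=
    Measurable.lintegral_prod_right' (f := fun z : ℝ × ℝ => H z.1 (z.1 * z.2))
      (hH.comp (by fun_prop : Measurable fun z : ℝ × ℝ => (z.1, z.1 * z.2)))
  have hHr : ∀ r, Measurable (H r) := fun r => hH.comp (by fun_prop : Measurable fun u => (r, u))
  have hHm : Measurable fun z : ℝ × ℝ => H z.1 z.2 := hH
  rw [lintegral_betaMeasure (by positivity) one_pos hin, mul_assoc]
  congr 1
  rw [← lintegral_const_mul' _ _ ENNReal.ofReal_ne_top]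
  calc _ = ∫⁻ r in Ioo (0 : ℝ) 1, ∫⁻ u in Ioo 0 r, ENNReal.ofReal (1 / beta a b) *
        (ENNReal.ofReal (u ^ (a - 1) * (r - u) ^ (b - 1)) * H r u) := by
        refine setLIntegral_congr_fun measurableSet_Ioo fun r hr => ?_
        rw [lintegral_const_mul' _ _ ENNReal.ofReal_ne_top,
          ← ofReal_rpow_mul_lintegral_scale hr.1 a b (hHr r),
          lintegral_betaMeasure ha hb (f := fun p => H r (r * p))
            ((hHr r).comp (measurable_const_mul r)), sub_self,
          Real.rpow_zero, mul_one, ← mul_assoc, ← mul_assoc, mul_comm (ENNReal.ofReal (r ^ _))]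
    _ = ∫⁻ u in Ioo (0 : ℝ) 1, ∫⁻ r in Ioo u 1, ENNReal.ofReal (1 / beta a b) *
        (ENNReal.ofReal (u ^ (a - 1) * (r - u) ^ (b - 1)) * H r u) := by
        refine setLIntegral_triangle_swap (K := fun r u => ENNReal.ofReal (1 / beta a b) *
          (ENNReal.ofReal (u ^ (a - 1) * (r - u) ^ (b - 1)) * H r u)) ?_
        unfold Function.uncurry
        fun_prop
    _ = _ := by
        refine setLIntegral_congr_fun measurableSet_Ioo fun u hu => ?_
        rw [lintegral_const_mul' _ _ ENNReal.ofReal_ne_top]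
        congr 1
        rw [← lintegral_const_mul' _ _ ENNReal.ofReal_ne_top]
        refine setLIntegral_congr_fun measurableSet_Ioo fun r hr => ?_
        rw [ENNReal.ofReal_mul (Real.rpow_nonneg hu.1.le _), mul_assoc]

lemma setLIntegral_Ioo_sub_rpow {b u : ℝ} (hb : 0 < b) (hu : u < 1) :
    ∫⁻ r in Ioo u 1, ENNReal.ofReal ((r - u) ^ (b - 1)) = ENNReal.ofReal ((1 - u) ^ b / b) := by
  have hi : IntervalIntegrable (fun x : ℝ => x ^ (b - 1)) volume (u - u) (1 - u) :=
    intervalIntegral.intervalIntegrable_rpow' (by linarith)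
  have hi' : IntervalIntegrable (fun r : ℝ => (r - u) ^ (b - 1)) volume u 1 := by
    simpa using hi.comp_sub_right u
  rw [← ofReal_integral_eq_lintegral_ofReal]
  · congr 1
    rw [← integral_Ioc_eq_integral_Ioo, ← intervalIntegral.integral_of_le hu.le,
      intervalIntegral.integral_comp_sub_right (fun x => x ^ (b - 1)),
      integral_rpow (Or.inl (by linarith))]
    simp [Real.zero_rpow hb.ne']
  · exact ((intervalIntegrable_iff_integrableOn_Ioc_of_le hu.le).1 hi').mono_set
      Ioo_subset_Ioc_self
  · refine ae_restrict_of_forall_mem measurableSet_Ioo fun r hr => ?_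
    exact Real.rpow_nonneg (by linarith [hr.1]) _

/-- If `R ∼ Beta(a + b, 1)` and `p ∼ Beta(a, b)` are independent then `R p ∼ Beta(a, b + 1)`. -/
lemma lintegral_betaMeasure_mul {a b : ℝ} (ha : 0 < a) (hb : 0 < b) {f : ℝ → ℝ≥0∞}
    (hf : Measurable f) :
    ∫⁻ r, ∫⁻ p, f (r * p) ∂betaMeasure a b ∂betaMeasure (a + b) 1 =
      ∫⁻ x, f x ∂betaMeasure a (b + 1) := by
  have := isProbabilityMeasureBeta ha hb
  have := isProbabilityMeasureBeta (add_pos ha hb) one_pos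
  have := isProbabilityMeasureBeta ha (add_pos hb one_pos)
  have h₁ : ∀ f : {f : ℝ → ℝ≥0∞ // Measurable f},
      ∫⁻ r, ∫⁻ p, f.1 (r * p) ∂betaMeasure a b ∂betaMeasure (a + b) 1 =
        (ENNReal.ofReal (1 / beta (a + b) 1) * ENNReal.ofReal (1 / beta a b) *
          ENNReal.ofReal (1 / b)) * ∫⁻ u in Ioo (0 : ℝ) 1,
            ENNReal.ofReal (u ^ (a - 1) * (1 - u) ^ (b + 1 - 1)) * f.1 u := by
    intro f
    have hf := f.2
    rw [lintegral_betaMeasure_mul_aux ha hb (H := fun _ u => f.1 u) (hf.comp measurable_snd),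
      mul_assoc (_ * _)]
    congr 1
    rw [← lintegral_const_mul' _ _ ENNReal.ofReal_ne_top]
    refine setLIntegral_congr_fun measurableSet_Ioo fun u hu => ?_
    have hu' : 0 < 1 - u := sub_pos.2 hu.2
    have hu0 : 0 < u := hu.1
    rw [lintegral_mul_const _ (by fun_prop), setLIntegral_Ioo_sub_rpow hb hu.2, ← mul_assoc,
      ← mul_assoc, ← ENNReal.ofReal_mul (by positivity), ← ENNReal.ofReal_mul (by positivity),
      add_sub_cancel_right]
    congr 2
    ring
  have h₂ : ∀ f : {f : ℝ → ℝ≥0∞ // Measurable f}, ∫⁻ x, f.1 x ∂betaMeasure a (b + 1) =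
      ENNReal.ofReal (1 / beta a (b + 1)) * ∫⁻ u in Ioo (0 : ℝ) 1,
        ENNReal.ofReal (u ^ (a - 1) * (1 - u) ^ (b + 1 - 1)) * f.1 u := fun f =>
    lintegral_betaMeasure ha (by positivity) f.2
  exact lintegral_eq_of_proportional (i₀ := ⟨fun _ => 1, measurable_const⟩)
    (u := fun f r => ∫⁻ p, f.1 (r * p) ∂betaMeasure a b) (by simp) rfl
    (ENNReal.ofReal_pos.2 (one_div_pos.2 (beta_pos ha (by positivity)))).ne' h₁ h₂ ⟨f, hf⟩

/-- The Dirichlet identity behind the comparison of posteriors: for independent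
`ψ ∼ Beta(a + 1, b)`, `B ∼ Beta(a, 1)` and independent `R ∼ Beta(a + b, 1)`, `p ∼ Beta(a, b)`, the
pairs `(1 - ψ, ψ B)` and `(R (1 - p), R p)` have the same law. -/
lemma lintegral_betaMeasure_split {a b : ℝ} (ha : 0 < a) (hb : 0 < b) {h : ℝ → ℝ → ℝ≥0∞}
    (hh : Measurable (Function.uncurry h)) :
    ∫⁻ ψ, ∫⁻ x, h (1 - ψ) (ψ * x) ∂betaMeasure a 1 ∂betaMeasure (a + 1) b =
      ∫⁻ r, ∫⁻ p, h (r * (1 - p)) (r * p) ∂betaMeasure a b ∂betaMeasure (a + b) 1 := by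
  have := isProbabilityMeasureBeta ha hb
  have := isProbabilityMeasureBeta (add_pos ha hb) one_pos
  have := isProbabilityMeasureBeta ha one_pos
  have := isProbabilityMeasureBeta (add_pos ha one_pos) hb
  have h₂ : ∀ h : {h : ℝ → ℝ → ℝ≥0∞ // Measurable (Function.uncurry h)},
      ∫⁻ r, ∫⁻ p, h.1 (r * (1 - p)) (r * p) ∂betaMeasure a b ∂betaMeasure (a + b) 1 =
        (ENNReal.ofReal (1 / beta (a + b) 1) * ENNReal.ofReal (1 / beta a b)) *
          ∫⁻ u in Ioo (0 : ℝ) 1, ENNReal.ofReal (u ^ (a - 1)) *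
            ∫⁻ y in Ioo 0 (1 - u), ENNReal.ofReal (y ^ (b - 1)) * h.1 y u := by
    intro h
    have hm := h.2
    have : ∀ r p : ℝ, h.1 (r * (1 - p)) (r * p) = (fun r u => h.1 (r - u) u) r (r * p) :=
      fun r p => by simp only [mul_sub, mul_one]
    simp_rw [this]
    rw [lintegral_betaMeasure_mul_aux ha hb (H := fun r u => h.1 (r - u) u)
      (hm.comp (by fun_prop : Measurable fun z : ℝ × ℝ => (z.1 - z.2, z.2)))]
    congr 1
    refine setLIntegral_congr_fun measurableSet_Ioo fun u hu => ?_
    congr 1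
    rw [← lintegral_indicator measurableSet_Ioo, ← lintegral_indicator measurableSet_Ioo]
    symm
    rw [← lintegral_sub_right_eq_self _ u]
    refine lintegral_congr fun r => ?_
    simp only [indicator_apply, mem_Ioo, sub_pos, sub_lt_sub_iff_right]
  have h₁ : ∀ h : {h : ℝ → ℝ → ℝ≥0∞ // Measurable (Function.uncurry h)},
      ∫⁻ ψ, ∫⁻ x, h.1 (1 - ψ) (ψ * x) ∂betaMeasure a 1 ∂betaMeasure (a + 1) b =
        (ENNReal.ofReal (1 / beta (a + 1) b) * ENNReal.ofReal (1 / beta a 1)) *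
          ∫⁻ u in Ioo (0 : ℝ) 1, ENNReal.ofReal (u ^ (a - 1)) *
            ∫⁻ y in Ioo 0 (1 - u), ENNReal.ofReal (y ^ (b - 1)) * h.1 y u := by
    intro h
    have hm : Measurable fun z : ℝ × ℝ => h.1 z.1 z.2 := h.2
    rw [lintegral_betaMeasure (by positivity) hb (Measurable.lintegral_prod_right'
      (f := fun z : ℝ × ℝ => h.1 (1 - z.1) (z.1 * z.2)) (by fun_prop)), mul_assoc]
    congr 1
    rw [← lintegral_const_mul' _ _ ENNReal.ofReal_ne_top]
    calc _ = ∫⁻ ψ in Ioo (0 : ℝ) 1, ∫⁻ u in Ioo 0 ψ, ENNReal.ofReal (1 / beta a 1) *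
          (ENNReal.ofReal (u ^ (a - 1)) * (ENNReal.ofReal ((1 - ψ) ^ (b - 1)) *
            h.1 (1 - ψ) u)) := by
          refine setLIntegral_congr_fun measurableSet_Ioo fun ψ hψ => ?_
          have hψ' : 0 ≤ ψ := hψ.1.le
          have hψ1 : 0 ≤ 1 - ψ := by linarith [hψ.2]
          have key := ofReal_rpow_mul_lintegral_scale hψ.1 a 1
            (G := fun u => h.1 (1 - ψ) u) (by fun_prop)
          simp only [sub_self, Real.rpow_zero, mul_one, add_sub_cancel_right] at key
          simp only
          rw [lintegral_const_mul' _ _ ENNReal.ofReal_ne_top,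
            lintegral_betaMeasure ha one_pos (by fun_prop)]
          simp_rw [fun u : ℝ => mul_left_comm (ENNReal.ofReal (u ^ (a - 1)))
            (ENNReal.ofReal ((1 - ψ) ^ (b - 1)))]
          rw [lintegral_const_mul' _ _ ENNReal.ofReal_ne_top, ← key, add_sub_cancel_right,
            ENNReal.ofReal_mul (by positivity)]
          simp only [sub_self, Real.rpow_zero, mul_one]
          ring
      _ = ∫⁻ u in Ioo (0 : ℝ) 1, ∫⁻ ψ in Ioo u 1, ENNReal.ofReal (1 / beta a 1) *
          (ENNReal.ofReal (u ^ (a - 1)) * (ENNReal.ofReal ((1 - ψ) ^ (b - 1)) *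
            h.1 (1 - ψ) u)) := by
          refine setLIntegral_triangle_swap (K := fun ψ u => ENNReal.ofReal (1 / beta a 1) *
            (ENNReal.ofReal (u ^ (a - 1)) * (ENNReal.ofReal ((1 - ψ) ^ (b - 1)) *
              h.1 (1 - ψ) u))) ?_
          unfold Function.uncurry
          fun_prop
      _ = _ := by
          refine setLIntegral_congr_fun measurableSet_Ioo fun u hu => ?_
          rw [lintegral_const_mul' _ _ ENNReal.ofReal_ne_top,
            lintegral_const_mul' _ _ ENNReal.ofReal_ne_top]
          congr 2
          rw [← lintegral_indicator measurableSet_Ioo, ← lintegral_indicator measurableSet_Ioo]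
          rw [← lintegral_sub_left_eq_self _ (1 : ℝ)]
          refine lintegral_congr fun y => ?_
          simp only [indicator_apply, mem_Ioo, sub_sub_cancel]
          refine if_congr ?_ rfl rfl
          constructor <;> rintro ⟨_, _⟩ <;> constructor <;> linarith
  exact lintegral_eq_of_proportional
    (ι := {h : ℝ → ℝ → ℝ≥0∞ // Measurable (Function.uncurry h)})
    (i₀ := ⟨fun _ _ => 1, measurable_const⟩)
    (u := fun h ψ => ∫⁻ x, h.1 (1 - ψ) (ψ * x) ∂betaMeasure a 1)
    (v := fun h r => ∫⁻ p, h.1 (r * (1 - p)) (r * p) ∂betaMeasure a b) (by simp) (by simp)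
    (mul_ne_zero (ENNReal.ofReal_pos.2 (one_div_pos.2 (beta_pos (add_pos ha hb) one_pos))).ne'
      (ENNReal.ofReal_pos.2 (one_div_pos.2 (beta_pos ha hb))).ne') h₁ h₂ ⟨h, hh⟩

/-! ### The stochastic order tested on increasing functions -/

/-- The usual stochastic order, in the form of inequalities between the expectations of all
increasing functions with values in `[0, 1]`. -/
def IncreasingLE (μ ν : Measure ℝ) : Prop :=
  ∀ g : ℝ → ℝ≥0∞, Monotone g → (∀ x, g x ≤ 1) → ∫⁻ x, g x ∂μ ≤ ∫⁻ x, g x ∂ν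

lemma IncreasingLE.refl (μ : Measure ℝ) : IncreasingLE μ μ := fun _ _ _ => le_rfl

lemma IncreasingLE.trans {μ ν ρ : Measure ℝ} (h₁ : IncreasingLE μ ν) (h₂ : IncreasingLE ν ρ) :
    IncreasingLE μ ρ := fun g hg hg' => (h₁ g hg hg').trans (h₂ g hg hg')

lemma IncreasingLE.stochLE {μ ν : Measure ℝ} (h : IncreasingLE μ ν) : StochLE μ ν := by
  intro x
  have := h ((Ioi x).indicator 1) ?_ fun y => indicator_le_self' (fun _ _ => zero_le_one) y
  · simpa [lintegral_indicator_one measurableSet_Ioi] using this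
  · intro y z hyz
    by_cases hy : y ∈ Ioi x
    · have hz : z ∈ Ioi x := lt_of_lt_of_le hy hyz
      rw [indicator_of_mem hy, indicator_of_mem hz, Pi.one_apply, Pi.one_apply]
    · simp [indicator_of_notMem hy]

/-- If `μ'` and `ν'` are the images of `μ` and `ν` under the reflection `x ↦ 1 - x`, an inequality
between `μ'` and `ν'` is the reverse inequality between `μ` and `ν`. -/
lemma IncreasingLE.of_reflect {μ ν μ' ν' : Measure ℝ} [IsProbabilityMeasure μ]
    [IsProbabilityMeasure ν] (hμ : ∀ f, Measurable f → ∫⁻ x, f x ∂μ' = ∫⁻ x, f (1 - x) ∂μ)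
    (hν : ∀ f, Measurable f → ∫⁻ x, f x ∂ν' = ∫⁻ x, f (1 - x) ∂ν) (h : IncreasingLE μ' ν') :
    IncreasingLE ν μ := by
  intro g hg hg'
  have hk : Monotone fun x => 1 - g (1 - x) := fun x y hxy =>
    tsub_le_tsub_left (hg (by linarith)) _
  have key := h _ hk fun _ => tsub_le_self
  rw [hμ _ hk.measurable, hν _ hk.measurable] at key
  simp only [sub_sub_cancel] at key
  have hsum : ∀ ρ : Measure ℝ, IsProbabilityMeasure ρ →
      ∫⁻ x, (1 - g x) ∂ρ + ∫⁻ x, g x ∂ρ = 1 := by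
    intro ρ _
    rw [← lintegral_add_right _ hg.measurable]
    simp [tsub_add_cancel_of_le (hg' _)]
  have hμ1 := hsum μ inferInstance
  have hν1 := hsum ν inferInstance
  have hfin : ∫⁻ x, (1 - g x) ∂ν ≠ ∞ := by
    intro htop
    simp [htop] at hν1
  refine (ENNReal.add_le_add_iff_left hfin).1 ?_
  exact (hν1.trans hμ1.symm).le.trans (add_le_add_left key _)

/-- `Beta(a, 1)` is stochastically increasing in `a`. -/
lemma lintegral_betaMeasure_one_le {a : ℝ} (ha : 0 < a) {G : ℝ → ℝ≥0∞} (hG : Monotone G) :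
    ∫⁻ x, G x ∂betaMeasure a 1 ≤ ∫⁻ x, G x ∂betaMeasure (a + 1) 1 := by
  have := isProbabilityMeasureBeta (add_pos one_pos ha) one_pos
  have hGm := hG.measurable
  have hG1 : Measurable fun x => G (1 - x) := by fun_prop
  rw [← lintegral_betaMeasure_one_sub one_pos ha hGm,
    ← lintegral_betaMeasure_one_sub one_pos (by positivity) hGm,
    ← lintegral_betaMeasure_mul one_pos ha hG1]
  calc ∫⁻ x, G (1 - x) ∂betaMeasure 1 a
      = ∫⁻ _, ∫⁻ x, G (1 - x) ∂betaMeasure 1 a ∂betaMeasure (1 + a) 1 := by simp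
    _ ≤ _ := by
      refine lintegral_mono_ae ?_
      filter_upwards [ae_mem_Ioo_betaMeasure (1 + a) 1] with r hr
      refine lintegral_mono_ae ?_
      filter_upwards [ae_mem_Ioo_betaMeasure 1 a] with p hp
      exact hG (by nlinarith [hr.1, hr.2, hp.1, hp.2])

/-! ### Laws along a path of the tree -/

/-- The conditional distribution function of a node at a marked point, in terms of the conditional
probability `ψ` of the child containing the marked point and of the conditional distribution
function `y` of that child.  The flag tells whether this child is the left one. -/
def pathStep (left : Bool) (ψ y : ℝ) : ℝ :=
  if left then ψ * y else 1 - ψ + ψ * y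

@[fun_prop]
lemma measurable_pathStep (left : Bool) : Measurable fun z : ℝ × ℝ => pathStep left z.1 z.2 := by
  unfold pathStep
  split_ifs <;> fun_prop

lemma monotone_pathStep (left : Bool) {ψ : ℝ} (hψ : 0 ≤ ψ) : Monotone (pathStep left ψ) := by
  intro y z hyz
  unfold pathStep
  split_ifs <;> gcongr

lemma pathStep_mem {left : Bool} {ψ y : ℝ} (hψ : ψ ∈ Icc (0 : ℝ) 1) (hy : y ∈ Icc (0 : ℝ) 1) :
    pathStep left ψ y ∈ Icc (0 : ℝ) 1 := by
  obtain ⟨h1, h2⟩ := hψ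
  obtain ⟨h3, h4⟩ := hy
  unfold pathStep
  split_ifs <;> constructor <;> nlinarith [mul_nonneg h1 h3]

/-- The number of observations inside the node of height `h` on the path, when the leaf on the path
holds `c 0` observations and the sibling of the path node of height `i` holds `c (i + 1)`. -/
def nodeCount (c : ℕ → ℕ) (h : ℕ) : ℕ := ∑ i ∈ Finset.range (h + 1), c i

/-- The posterior law of the conditional distribution function, at a marked point, of the node of
height `h` on the path from a leaf to the root, under uniform priors.  The path node of height `i`
is a left child iff `b i`, the conditional distribution function of the leaf at the marked point
is `x₀`, and `c` lists the numbers of observations as in `nodeCount`. -/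
noncomputable def pathLaw (b : ℕ → Bool) (x₀ : ℝ) (c : ℕ → ℕ) : ℕ → Measure ℝ
  | 0 => Measure.dirac x₀
  | h + 1 => ((betaMeasure (1 + nodeCount c h) (1 + c (h + 1))).prod (pathLaw b x₀ c h)).map
      fun z => pathStep (b h) z.1 z.2

instance isProbabilityMeasure_pathLaw (b : ℕ → Bool) (x₀ : ℝ) (c : ℕ → ℕ) (h : ℕ) :
    IsProbabilityMeasure (pathLaw b x₀ c h) := by
  induction h with
  | zero => unfold pathLaw; infer_instance
  | succ h ih =>
    have : IsProbabilityMeasure (betaMeasure (1 + nodeCount c h) (1 + c (h + 1))) :=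
      isProbabilityMeasureBeta (by positivity) (by positivity)
    unfold pathLaw
    exact Measure.isProbabilityMeasure_map (measurable_pathStep _).aemeasurable

lemma lintegral_pathLaw_succ (b : ℕ → Bool) (x₀ : ℝ) (c : ℕ → ℕ) (h : ℕ) {f : ℝ → ℝ≥0∞}
    (hf : Measurable f) :
    ∫⁻ x, f x ∂pathLaw b x₀ c (h + 1) =
      ∫⁻ ψ, ∫⁻ y, f (pathStep (b h) ψ y) ∂pathLaw b x₀ c h
        ∂betaMeasure (1 + nodeCount c h) (1 + c (h + 1)) := by
  have : IsProbabilityMeasure (betaMeasure (1 + nodeCount c h) (1 + c (h + 1))) :=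
    isProbabilityMeasureBeta (by positivity) (by positivity)
  rw [pathLaw, lintegral_map hf (measurable_pathStep _), lintegral_prod]
  exact (hf.comp (measurable_pathStep _)).aemeasurable

lemma ae_mem_Icc_pathLaw (b : ℕ → Bool) {x₀ : ℝ} (hx₀ : x₀ ∈ Icc (0 : ℝ) 1) (c : ℕ → ℕ) (h : ℕ) :
    ∀ᵐ y ∂pathLaw b x₀ c h, y ∈ Icc (0 : ℝ) 1 := by
  induction h with
  | zero =>
    exact (ae_dirac_iff measurableSet_Icc).2 hx₀
  | succ h ih =>
    have : IsProbabilityMeasure (betaMeasure (1 + nodeCount c h) (1 + c (h + 1))) :=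
      isProbabilityMeasureBeta (by positivity) (by positivity)
    refine (ae_map_iff (measurable_pathStep _).aemeasurable measurableSet_Icc).2 ?_
    have h1 := Measure.quasiMeasurePreserving_fst
      (μ := betaMeasure (1 + nodeCount c h) (1 + c (h + 1))) (ν := pathLaw b x₀ c h) |>.ae
      (ae_mem_Ioo_betaMeasure _ _)
    have h2 := Measure.quasiMeasurePreserving_snd
      (μ := betaMeasure (1 + nodeCount c h) (1 + c (h + 1))) (ν := pathLaw b x₀ c h) |>.ae ih
    filter_upwards [h1, h2] with z hz1 hz2
    exact pathStep_mem (Ioo_subset_Icc_self hz1) hz2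

lemma nodeCount_congr {c c' : ℕ → ℕ} {h : ℕ} (hc : ∀ i ≤ h, c i = c' i) :
    nodeCount c h = nodeCount c' h :=
  Finset.sum_congr rfl fun i hi => hc i (by simpa [Nat.lt_succ_iff] using hi)

lemma pathLaw_congr (b : ℕ → Bool) (x₀ : ℝ) {c c' : ℕ → ℕ} {h : ℕ} (hc : ∀ i ≤ h, c i = c' i) :
    pathLaw b x₀ c h = pathLaw b x₀ c' h := by
  induction h with
  | zero => rfl
  | succ h ih =>
    unfold pathLaw
    rw [ih fun i hi => hc i (by omega), hc (h + 1) le_rfl,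
      nodeCount_congr (h := h) fun i hi => hc i (by omega)]

lemma nodeCount_succ (c : ℕ → ℕ) (h : ℕ) : nodeCount c (h + 1) = nodeCount c h + c (h + 1) :=
  Finset.sum_range_succ _ _

/-- One more observation in the part of the tree with index `m`. -/
abbrev addObs (c : ℕ → ℕ) (m : ℕ) : ℕ → ℕ := c + (Pi.single m 1 : ℕ → ℕ)

lemma nodeCount_addObs (c : ℕ → ℕ) {m h : ℕ} (hm : m ≤ h) :
    nodeCount (addObs c m) h = nodeCount c h + 1 := by
  simp only [nodeCount, addObs, Pi.add_apply, Finset.sum_add_distrib]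
  congr 1
  simp only [Pi.single_apply, Finset.sum_ite_eq', Finset.mem_range]
  rw [if_pos (by omega)]

lemma nodeCount_addObs_of_lt (c : ℕ → ℕ) {m h : ℕ} (hm : h < m) :
    nodeCount (addObs c m) h = nodeCount c h :=
  nodeCount_congr fun i hi => by simp [addObs, show i ≠ m by omega]

lemma pathLaw_addObs_of_lt (b : ℕ → Bool) (x₀ : ℝ) (c : ℕ → ℕ) {m h : ℕ} (hm : h < m) :
    pathLaw b x₀ (addObs c m) h = pathLaw b x₀ c h :=
  pathLaw_congr b x₀ fun i hi => by simp [addObs, show i ≠ m by omega]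

lemma measurable_lintegral_pathStep {Ω : Type*} [MeasurableSpace Ω] {μ : Measure ℝ} [SFinite μ]
    {F : Ω → ℝ → ℝ} {g : ℝ → ℝ≥0∞} (hg : Measurable g)
    (hF : Measurable fun z : Ω × ℝ => F z.1 z.2) :
    Measurable fun ψ => ∫⁻ y, g (F ψ y) ∂μ :=
  Measurable.lintegral_prod_right' (f := fun z : Ω × ℝ => g (F z.1 z.2)) (hg.comp hF)

/-- The Dirichlet identity, for a node whose path child has weight `ψ ∼ Beta(a + 1, β)` and a
conditional distribution function rescaled by an independent `Beta(a, 1)` variable: the rescaling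
moves from the child to the node, with `Beta(a, β)` as the new law of the weight. -/
lemma lintegral_pathStep_rescale (left : Bool) {a β : ℝ} (ha : 0 < a) (hβ : 0 < β)
    (μ : Measure ℝ) [SFinite μ] {g : ℝ → ℝ≥0∞} (hg : Measurable g) :
    ∫⁻ ψ, ∫⁻ x, ∫⁻ y, g (pathStep left ψ (x * y)) ∂μ ∂betaMeasure a 1 ∂betaMeasure (a + 1) β =
      ∫⁻ r, ∫⁻ p, ∫⁻ y, g (r * pathStep left p y) ∂μ ∂betaMeasure a β
        ∂betaMeasure (a + β) 1 := by
  have key := lintegral_betaMeasure_split ha hβ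
    (h := fun x z => ∫⁻ y, g (if left then z * y else x + z * y) ∂μ) ?_
  · convert key using 7
    · simp only [pathStep, mul_assoc]
    · simp only [pathStep]
      congr 1
      split_ifs <;> ring
  · refine measurable_lintegral_pathStep (F := fun z : ℝ × ℝ => fun y =>
      if left then z.2 * y else z.1 + z.2 * y) hg ?_
    split_ifs <;> fun_prop

/-- The conditional distribution function of a node holding `N + 1` observations is stochastically
at least `r` times the one obtained by deleting any of these observations, where
`r ∼ Beta(N + 2, 1)` is independent.  The induction over the height only uses the weaker bound
with `Beta(N + 1, 1)` for the path child. -/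
lemma lintegral_pathLaw_addObs (b : ℕ → Bool) {x₀ : ℝ} (hx₀ : x₀ ∈ Icc (0 : ℝ) 1) (c : ℕ → ℕ)
    {m h : ℕ} (hm : m ≤ h) {g : ℝ → ℝ≥0∞} (hg : Monotone g) :
    ∫⁻ r, ∫⁻ y, g (r * y) ∂pathLaw b x₀ c h ∂betaMeasure (nodeCount c h + 1 + 1) 1 ≤
      ∫⁻ y, g y ∂pathLaw b x₀ (addObs c m) h := by
  induction h generalizing g with
  | zero =>
    have : IsProbabilityMeasure (betaMeasure (nodeCount c 0 + 1 + 1) 1) :=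
      isProbabilityMeasureBeta (by positivity) one_pos
    simp only [pathLaw, lintegral_dirac]
    calc _ ≤ ∫⁻ _, g x₀ ∂betaMeasure (nodeCount c 0 + 1 + 1) 1 := by
          refine lintegral_mono_ae ?_
          filter_upwards [ae_mem_Ioo_betaMeasure (nodeCount c 0 + 1 + 1) 1] with r hr
          exact hg (mul_le_of_le_one_left hx₀.1 hr.2.le)
      _ = g x₀ := by simp
  | succ h ih =>
    have hgm := hg.measurable
    have hsum : ((nodeCount c (h + 1) : ℕ) : ℝ) + 1 + 1 =
        (nodeCount c h + 1) + (1 + c (h + 1)) := by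
      rw [nodeCount_succ]; push_cast; ring
    rw [lintegral_pathLaw_succ _ _ _ _ hgm]
    simp_rw [fun r : ℝ => lintegral_pathLaw_succ b x₀ c h (f := fun y => g (r * y)) (by fun_prop)]
    rw [hsum, add_comm (1 : ℝ) (nodeCount c h : ℝ)]
    rcases Nat.lt_or_ge h m with hlt | hle
    · -- The deleted observation lies in the sibling of the path child.
      obtain rfl : m = h + 1 := by omega
      rw [pathLaw_addObs_of_lt _ _ _ hlt, nodeCount_addObs_of_lt _ hlt]
      have : ((addObs c (h + 1) (h + 1) : ℕ) : ℝ) = c (h + 1) + 1 := by simp [addObs]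
      rw [this, add_comm (1 : ℝ) (nodeCount c h : ℝ), ← add_assoc (1 : ℝ),
        ← lintegral_betaMeasure_mul (by positivity) (by positivity)
          (measurable_lintegral_pathStep hgm (measurable_pathStep _))]
      refine lintegral_mono_ae ?_
      filter_upwards [ae_mem_Ioo_betaMeasure
        ((nodeCount c h : ℝ) + 1 + (1 + c (h + 1))) 1] with r hr
      refine lintegral_mono fun p => lintegral_mono fun y => hg ?_
      unfold pathStep
      split_ifs
      · rw [mul_assoc]
      · nlinarith [hr.2]
    · -- The deleted observation lies inside the path child.
      have : addObs c m (h + 1) = c (h + 1) := by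
        simp [addObs, show h + 1 ≠ m by omega]
      rw [nodeCount_addObs c hle, this, Nat.cast_add, Nat.cast_one,
        add_comm (1 : ℝ) ((nodeCount c h : ℝ) + 1),
        ← lintegral_pathStep_rescale (b h) (by positivity) (by positivity) _ hgm]
      refine lintegral_mono_ae ?_
      filter_upwards [ae_mem_Ioo_betaMeasure (nodeCount c h + 1 + 1) (1 + c (h + 1))] with ψ hψ
      have hstep : Monotone fun y => g (pathStep (b h) ψ y) :=
        hg.comp (monotone_pathStep _ hψ.1.le)
      refine le_trans ?_ (ih hle hstep)
      have hae := ae_mem_Icc_pathLaw b hx₀ c h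
      refine lintegral_betaMeasure_one_le (by positivity) fun r s hrs => ?_
      refine lintegral_mono_ae ?_
      filter_upwards [hae] with y hy
      exact hstep (mul_le_mul_of_nonneg_right hrs hy.1)

lemma lintegral_pathLaw_addObs' (b : ℕ → Bool) {x₀ : ℝ} (hx₀ : x₀ ∈ Icc (0 : ℝ) 1) (c : ℕ → ℕ)
    {m h : ℕ} (hm : m ≤ h) {g : ℝ → ℝ≥0∞} (hg : Monotone g) :
    ∫⁻ r, ∫⁻ y, g (r * y) ∂pathLaw b x₀ c h ∂betaMeasure (nodeCount c h + 1) 1 ≤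
      ∫⁻ y, g y ∂pathLaw b x₀ (addObs c m) h := by
  refine le_trans ?_ (lintegral_pathLaw_addObs b hx₀ c hm hg)
  refine lintegral_betaMeasure_one_le (by positivity) fun r s hrs => lintegral_mono_ae ?_
  filter_upwards [ae_mem_Icc_pathLaw b hx₀ c h] with y hy
  exact hg (mul_le_mul_of_nonneg_right hrs hy.1)

/-- Moving an observation from inside the path node of height `k`, a left child, to its right
sibling decreases the distribution function at the marked point. -/
lemma pathLaw_addObs_le_of_left (b : ℕ → Bool) {x₀ : ℝ} (hx₀ : x₀ ∈ Icc (0 : ℝ) 1) (c : ℕ → ℕ)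
    {m k h : ℕ} (hmk : m ≤ k) (hb : b k = true) (hkh : k < h) :
    IncreasingLE (pathLaw b x₀ (addObs c (k + 1)) h) (pathLaw b x₀ (addObs c m) h) := by
  induction h with
  | zero => omega
  | succ h ih =>
    intro g hg hg'
    have hgm := hg.measurable
    rw [lintegral_pathLaw_succ _ _ _ _ hgm, lintegral_pathLaw_succ _ _ _ _ hgm]
    have hm : addObs c m (h + 1) = c (h + 1) := by
      simp [addObs, show h + 1 ≠ m by omega]
    rw [nodeCount_addObs c (show m ≤ h by omega), hm]
    rcases Nat.lt_or_ge k h with hlt | hge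
    · have hk : addObs c (k + 1) (h + 1) = c (h + 1) := by
        simp [addObs, show h ≠ k by omega]
      rw [nodeCount_addObs c (show k + 1 ≤ h by omega), hk]
      refine lintegral_mono_ae ?_
      filter_upwards [ae_mem_Ioo_betaMeasure (1 + ((nodeCount c h + 1 : ℕ) : ℝ)) (1 + c (h + 1))]
        with ψ hψ
      exact ih hlt _ (hg.comp (monotone_pathStep _ hψ.1.le)) fun _ => hg' _
    · obtain rfl : k = h := by omega
      rw [pathLaw_addObs_of_lt _ _ _ (Nat.lt_succ_self k),
        nodeCount_addObs_of_lt _ (Nat.lt_succ_self k)]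
      have : ((addObs c (k + 1) (k + 1) : ℕ) : ℝ) = c (k + 1) + 1 := by simp [addObs]
      rw [this, add_comm (1 : ℝ) (nodeCount c k : ℝ), ← add_assoc (1 : ℝ), Nat.cast_add,
        Nat.cast_one, add_comm (1 : ℝ) ((nodeCount c k : ℝ) + 1),
        ← lintegral_betaMeasure_mul (by positivity) (by positivity)
          (measurable_lintegral_pathStep hgm (measurable_pathStep _))]
      have e : ∀ r p y : ℝ, pathStep (b k) (r * p) y = r * pathStep (b k) p y := by
        intro r p y
        simp only [pathStep, hb, if_true, mul_assoc]
      simp_rw [e]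
      rw [← lintegral_pathStep_rescale (b k) (by positivity) (by positivity) _ hgm]
      refine lintegral_mono_ae ?_
      filter_upwards [ae_mem_Ioo_betaMeasure (nodeCount c k + 1 + 1) (1 + c (k + 1))] with ψ hψ
      exact lintegral_pathLaw_addObs' b hx₀ c hmk (hg.comp (monotone_pathStep (b k) hψ.1.le))

/-- Reflecting the tree exchanges left and right and turns the distribution function `F` at the
marked point into `1 - F`. -/
lemma lintegral_pathLaw_reflect (b : ℕ → Bool) (x₀ : ℝ) (c : ℕ → ℕ) (h : ℕ) {f : ℝ → ℝ≥0∞}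
    (hf : Measurable f) :
    ∫⁻ y, f y ∂pathLaw (fun i => !b i) (1 - x₀) c h = ∫⁻ y, f (1 - y) ∂pathLaw b x₀ c h := by
  induction h generalizing f with
  | zero =>
    simp only [pathLaw, lintegral_dirac]
  | succ h ih =>
    rw [lintegral_pathLaw_succ _ _ _ _ hf,
      lintegral_pathLaw_succ _ _ _ _ (f := fun y => f (1 - y)) (by fun_prop)]
    refine lintegral_congr fun ψ => ?_
    rw [ih (f := fun y => f (pathStep (!b h) ψ y))
      (hf.comp ((measurable_pathStep _).comp (measurable_const.prodMk measurable_id)))]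
    refine lintegral_congr fun y => ?_
    congr 1
    cases b h <;> simp [pathStep] <;> ring

/-- Moving an observation from the left sibling of the path node of height `k` to the inside of
this node decreases the distribution function at the marked point. -/
lemma pathLaw_addObs_le_of_right (b : ℕ → Bool) {x₀ : ℝ} (hx₀ : x₀ ∈ Icc (0 : ℝ) 1) (c : ℕ → ℕ)
    {m k h : ℕ} (hmk : m ≤ k) (hb : b k = false) (hkh : k < h) :
    IncreasingLE (pathLaw b x₀ (addObs c m) h) (pathLaw b x₀ (addObs c (k + 1)) h) :=
  IncreasingLE.of_reflect (fun _ hf => lintegral_pathLaw_reflect b x₀ _ h hf)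
    (fun _ hf => lintegral_pathLaw_reflect b x₀ _ h hf)
    (pathLaw_addObs_le_of_left (fun i => !b i)
      ⟨by linarith [hx₀.2], by linarith [hx₀.1]⟩ c hmk (by simp [hb]) hkh)

/-! ### Finite products of probability measures -/

/-- If reweighting each factor by `w i` gives `Z i` times the probability measure `ν i`, then
reweighting the product by `∏ w i` gives `∏ Z i` times the product of the `ν i`. -/
lemma lintegral_pi_reweight {ι α : Type*} [Fintype ι] [MeasurableSpace α]
    {μ ν : ι → Measure α} [∀ i, IsProbabilityMeasure (μ i)] [∀ i, IsProbabilityMeasure (ν i)]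
    {w : ι → α → ℝ≥0∞} (hw : ∀ i, Measurable (w i)) {Z : ι → ℝ≥0∞} (hZ : ∀ i, Z i ≠ 0)
    (hZ' : ∀ i, Z i ≠ ∞)
    (h : ∀ i (f : α → ℝ≥0∞), Measurable f → ∫⁻ x, w i x * f x ∂μ i = Z i * ∫⁻ x, f x ∂ν i)
    {G : (ι → α) → ℝ≥0∞} (hG : Measurable G) :
    ∫⁻ x, (∏ i, w i (x i)) * G x ∂Measure.pi μ = (∏ i, Z i) * ∫⁻ x, G x ∂Measure.pi ν := by
  have hZ0 : ∏ i, Z i ≠ 0 := Finset.prod_ne_zero_iff.2 fun i _ => hZ i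
  have hZt : ∏ i, Z i ≠ ∞ := ENNReal.prod_ne_top fun i _ => hZ' i
  have hW : Measurable fun x : ι → α => ∏ i, w i (x i) :=
    Finset.measurable_fun_prod _ fun i _ => (hw i).comp (measurable_pi_apply i)
  have hpi : Measure.pi ν =
      (∏ i, Z i)⁻¹ • (Measure.pi μ).withDensity fun x => ∏ i, w i (x i) := by
    refine Measure.pi_eq fun t ht => ?_
    have hbox : MeasurableSet (univ.pi t) := MeasurableSet.univ_pi ht
    have hind := iIndepFun_pi (μ := μ) (X := fun i => (t i).indicator (w i))
      fun i => ((hw i).indicator (ht i)).aemeasurable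
    have hprod := lintegral_prod_eq_prod_lintegral_of_indepFun Finset.univ _ hind
      fun i => ((hw i).indicator (ht i)).comp (measurable_pi_apply i)
    have hcoord : ∀ i, ∫⁻ x : ι → α, (t i).indicator (w i) (x i) ∂Measure.pi μ =
        Z i * ν i (t i) := by
      intro i
      have e := (measurePreserving_eval μ i).lintegral_comp ((hw i).indicator (ht i))
      simp only [Function.eval] at e
      rw [e, ← lintegral_indicator_one (ht i), ← h i _ (measurable_one.indicator (ht i))]
      refine lintegral_congr fun x => ?_
      by_cases hx : x ∈ t i <;> simp [hx]
    rw [Measure.smul_apply, withDensity_apply _ hbox, ← lintegral_indicator hbox, smul_eq_mul]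
    have e : ∀ x : ι → α, (univ.pi t).indicator (fun x => ∏ i, w i (x i)) x =
        ∏ i, (t i).indicator (w i) (x i) := by
      intro x
      by_cases hx : x ∈ univ.pi t
      · rw [indicator_of_mem hx]
        exact Finset.prod_congr rfl fun i _ => (indicator_of_mem (hx i (mem_univ i)) _).symm
      · rw [indicator_of_notMem hx]
        obtain ⟨i, hi⟩ : ∃ i, x i ∉ t i := by simpa [Set.mem_pi] using hx
        exact (Finset.prod_eq_zero (Finset.mem_univ i) (indicator_of_notMem hi _)).symm
    rw [lintegral_congr e, hprod, Finset.prod_congr rfl fun i _ => hcoord i,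
      Finset.prod_mul_distrib, ← mul_assoc, ENNReal.inv_mul_cancel hZ0 hZt, one_mul]
  rw [hpi, lintegral_smul_measure, lintegral_withDensity_eq_lintegral_mul _ hW hG, smul_eq_mul,
    ← mul_assoc, ENNReal.mul_inv_cancel hZ0 hZt, one_mul]
  rfl

/-- A coordinate of a finite product may be integrated out separately. -/
lemma lintegral_pi_update {ι : Type*} {α : ι → Type*} [Fintype ι] [DecidableEq ι]
    [∀ i, MeasurableSpace (α i)] (ν : ∀ i, Measure (α i)) [∀ i, IsProbabilityMeasure (ν i)]
    (i : ι) {f : (∀ i, α i) → ℝ≥0∞} (hf : Measurable f) :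
    ∫⁻ x, f x ∂Measure.pi ν =
      ∫⁻ x, ∫⁻ y, f (Function.update x i y) ∂ν i ∂Measure.pi ν := by
  have e := lmarginal_singleton (μ := ν) f i
  refine lintegral_eq_of_lmarginal_eq {i} hf ?_ ?_
  · rw [← e]
    exact hf.lmarginal ν
  · rw [lmarginal_singleton, lmarginal_singleton]
    simp

/-! ### The tree -/

lemma split_ext {L : ℕ} {s t : Split L} (h₁ : (s.1 : ℕ) = t.1) (h₂ : (s.2 : ℕ) = t.2) :
    s = t := by
  obtain ⟨⟨l, hl⟩, ⟨q, hq⟩⟩ := s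
  obtain ⟨⟨l', hl'⟩, ⟨q', hq'⟩⟩ := t
  obtain rfl : l = l' := h₁
  obtain rfl : q = q' := h₂
  rfl

/-- The conditional probability of the direction in which leaf `i` branches off at the split `s`,
which has value `x`; it is `1` if `i` is not below `s`. -/
def branchFactor {L : ℕ} (s : Split L) (i : ℕ) (x : ℝ) : ℝ :=
  if i / 2 ^ (L - s.1) = s.2 then
    if i / 2 ^ (L - s.1 - 1) % 2 = 0 then x else 1 - x
  else 1

lemma intervalProb_eq_prod {L : ℕ} (φ : Split L → ℝ) (l : ℕ) (hl : l ≤ L) (i : Fin (2 ^ l)) :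
    intervalProb φ l hl i = ∏ s : Split L, if (s.1 : ℕ) < l ∧ (i : ℕ) / 2 ^ (l - s.1) = s.2 then
      if (i : ℕ) / 2 ^ (l - s.1 - 1) % 2 = 0 then φ s else 1 - φ s else 1 := by
  induction l with
  | zero => simp [intervalProb]
  | succ l ih =>
    have hp : (i : ℕ) / 2 < 2 ^ l := Nat.div_lt_of_lt_mul (by have := i.isLt; omega)
    let s₀ : Split L := ⟨⟨l, hl⟩, ⟨(i : ℕ) / 2, hp⟩⟩
    have hw : (if (i : ℕ) % 2 = 0 then φ s₀ else 1 - φ s₀) =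
        ∏ s : Split L, if s = s₀ then (if (i : ℕ) % 2 = 0 then φ s else 1 - φ s) else 1 := by
      rw [Finset.prod_ite_eq' Finset.univ s₀]
      simp
    have hrec : intervalProb φ (l + 1) hl i = (if (i : ℕ) % 2 = 0 then φ s₀ else 1 - φ s₀) *
        intervalProb φ l (Nat.le_of_succ_le hl) ⟨(i : ℕ) / 2, hp⟩ := rfl
    rw [hrec, hw, ih, ← Finset.prod_mul_distrib]
    refine Finset.prod_congr rfl fun s _ => ?_
    rcases lt_trichotomy (s.1 : ℕ) l with hs | hs | hs
    · have hne : s ≠ s₀ := fun h => by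
        have : (s.1 : ℕ) = l := by rw [h]
        omega
      have e₁ : (i : ℕ) / 2 / 2 ^ (l - s.1) = (i : ℕ) / 2 ^ (l + 1 - s.1) := by
        rw [Nat.div_div_eq_div_mul, ← pow_succ', show l - s.1 + 1 = l + 1 - s.1 by omega]
      have e₂ : (i : ℕ) / 2 / 2 ^ (l - s.1 - 1) = (i : ℕ) / 2 ^ (l + 1 - s.1 - 1) := by
        rw [Nat.div_div_eq_div_mul, ← pow_succ', show l - s.1 - 1 + 1 = l + 1 - s.1 - 1 by omega]
      simp [hne, hs, hs.trans (Nat.lt_succ_self l), e₁, e₂]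
    · have e₁ : l + 1 - (s.1 : ℕ) = 1 := by omega
      have hiff : s = s₀ ↔ (i : ℕ) / 2 = s.2 :=
        ⟨fun h => by rw [h], fun h => split_ext hs h.symm⟩
      simp [hiff, hs]
    · have hne : s ≠ s₀ := fun h => by
        have : (s.1 : ℕ) = l := by rw [h]
        omega
      simp [hne, show ¬ (s.1 : ℕ) < l by omega, show ¬ (s.1 : ℕ) < l + 1 by omega]

lemma leafProb_eq_prod {L : ℕ} (φ : Split L → ℝ) (i : Fin (2 ^ L)) :
    leafProb φ i = ∏ s : Split L, branchFactor s i (φ s) := by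
  rw [leafProb, intervalProb_eq_prod]
  refine Finset.prod_congr rfl fun s _ => ?_
  simp [branchFactor, s.1.isLt]

/-- The number of observations, allocated to leaves by `i`, in the left child of the split `s`. -/
def leftCount {L K : ℕ} (i : Fin K → Fin (2 ^ L)) (s : Split L) : ℕ :=
  (Finset.univ.filter fun k => (i k : ℕ) / 2 ^ (L - s.1) = s.2 ∧
    (i k : ℕ) / 2 ^ (L - s.1 - 1) % 2 = 0).card

/-- The number of observations, allocated to leaves by `i`, in the right child of the split `s`. -/
def rightCount {L K : ℕ} (i : Fin K → Fin (2 ^ L)) (s : Split L) : ℕ :=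
  (Finset.univ.filter fun k => (i k : ℕ) / 2 ^ (L - s.1) = s.2 ∧
    ¬ (i k : ℕ) / 2 ^ (L - s.1 - 1) % 2 = 0).card

lemma prod_branchFactor {L K : ℕ} (i : Fin K → Fin (2 ^ L)) (s : Split L) (x : ℝ) :
    ∏ k, branchFactor s (i k) x = x ^ leftCount i s * (1 - x) ^ rightCount i s := by
  rw [leftCount, rightCount, ← Finset.prod_const, ← Finset.prod_const, Finset.prod_filter,
    Finset.prod_filter, ← Finset.prod_mul_distrib]
  refine Finset.prod_congr rfl fun k _ => ?_
  unfold branchFactor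
  split_ifs <;> simp_all

lemma prod_ofReal_leafProb {L K : ℕ} {φ : Split L → ℝ} (hφ : ∀ s, φ s ∈ Icc (0 : ℝ) 1)
    (i : Fin K → Fin (2 ^ L)) :
    ∏ k, ENNReal.ofReal (leafProb φ (i k)) = ∏ s, (ENNReal.ofReal (φ s) ^ leftCount i s *
      ENNReal.ofReal (1 - φ s) ^ rightCount i s) := by
  have hb : ∀ s (k : Fin K), 0 ≤ branchFactor s (i k) (φ s) := by
    intro s k
    have := hφ s
    unfold branchFactor
    split_ifs <;> simp [this.1, this.2]
  simp_rw [leafProb_eq_prod]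
  rw [← ENNReal.ofReal_prod_of_nonneg fun k _ => Finset.prod_nonneg fun s _ => hb s k,
    Finset.prod_comm, ENNReal.ofReal_prod_of_nonneg fun s _ => Finset.prod_nonneg fun k _ => hb s k]
  refine Finset.prod_congr rfl fun s _ => ?_
  have h0 := (hφ s).1
  have h1 : 0 ≤ 1 - φ s := sub_nonneg.2 (hφ s).2
  rw [prod_branchFactor, ENNReal.ofReal_mul (by positivity), ENNReal.ofReal_pow h0,
    ENNReal.ofReal_pow h1]

lemma ae_mem_Icc_pi_betaMeasure {L : ℕ} {α β : Split L → ℝ} (hα : ∀ s, 0 < α s)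
    (hβ : ∀ s, 0 < β s) :
    ∀ᵐ φ ∂Measure.pi fun s => betaMeasure (α s) (β s), ∀ s, φ s ∈ Icc (0 : ℝ) 1 := by
  have : ∀ s, IsProbabilityMeasure (betaMeasure (α s) (β s)) := fun s =>
    isProbabilityMeasureBeta (hα s) (hβ s)
  rw [ae_all_iff]
  intro s
  have := (Measure.quasiMeasurePreserving_eval (fun s => betaMeasure (α s) (β s)) s).ae
    (ae_mem_Ioo_betaMeasure (α s) (β s))
  filter_upwards [this] with φ hφ using Ioo_subset_Icc_self hφ

/-- Conjugacy of the finite Polya tree: given observations in the leaves `i k`, the splits remain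
independent, and the parameters of each are increased by the numbers of observations in its
children. -/
lemma lintegral_pi_betaMeasure_leafProb {L K : ℕ} {α β : Split L → ℝ} (hα : ∀ s, 0 < α s)
    (hβ : ∀ s, 0 < β s) (i : Fin K → Fin (2 ^ L)) {G : (Split L → ℝ) → ℝ≥0∞}
    (hG : Measurable G) :
    ∫⁻ φ, (∏ k, ENNReal.ofReal (leafProb φ (i k))) * G φ
        ∂Measure.pi (fun s => betaMeasure (α s) (β s)) =
      (∏ s, ENNReal.ofReal (beta (α s + leftCount i s) (β s + rightCount i s) /
        beta (α s) (β s))) *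
        ∫⁻ φ, G φ ∂Measure.pi fun s =>
          betaMeasure (α s + leftCount i s) (β s + rightCount i s) := by
  have hα' : ∀ s, 0 < α s + leftCount i s := fun s =>
    add_pos_of_pos_of_nonneg (hα s) (by positivity)
  have hβ' : ∀ s, 0 < β s + rightCount i s := fun s =>
    add_pos_of_pos_of_nonneg (hβ s) (by positivity)
  have : ∀ s, IsProbabilityMeasure (betaMeasure (α s) (β s)) := fun s =>
    isProbabilityMeasureBeta (hα s) (hβ s)
  have : ∀ s, IsProbabilityMeasure
      (betaMeasure (α s + leftCount i s) (β s + rightCount i s)) := fun s =>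
    isProbabilityMeasureBeta (hα' s) (hβ' s)
  rw [← lintegral_pi_reweight (μ := fun s => betaMeasure (α s) (β s))
    (w := fun s x => ENNReal.ofReal x ^ leftCount i s * ENNReal.ofReal (1 - x) ^ rightCount i s)
    (fun s => by fun_prop)
    (fun s => (ENNReal.ofReal_pos.2 (div_pos (beta_pos (hα' s) (hβ' s))
      (beta_pos (hα s) (hβ s)))).ne') (fun s => ENNReal.ofReal_ne_top)
    (fun s f hf => lintegral_betaMeasure_conjugate (hα s) (hβ s) _ _ hf) hG]
  refine lintegral_congr_ae ?_
  filter_upwards [ae_mem_Icc_pi_betaMeasure hα hβ] with φ hφ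
  rw [prod_ofReal_leafProb hφ]

/-! ### The path from a leaf to the root -/

/-- The split of the node of height `h + 1` above the leaf `J`. -/
def pathSplit {L : ℕ} (J : Fin (2 ^ L)) (h : ℕ) (hh : h < L) : Split L :=
  ⟨⟨L - 1 - h, by omega⟩, ⟨(J : ℕ) / 2 ^ (h + 1), by
    refine Nat.div_lt_of_lt_mul ?_
    rw [← pow_add, show h + 1 + (L - 1 - h) = L by omega]
    exact J.isLt⟩⟩

/-- Whether the node of height `h` above the leaf `J` is a left child. -/
def isLeft (J : ℕ) (h : ℕ) : Bool := decide (J / 2 ^ h % 2 = 0)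

/-- The conditional distribution function, at a marked point of the leaf `J`, of the node of height
`h` above this leaf; `x₀` is the conditional distribution function of the leaf itself. -/
noncomputable def pathCDF {L : ℕ} (J : Fin (2 ^ L)) (x₀ : ℝ) (φ : Split L → ℝ) : ℕ → ℝ
  | 0 => x₀
  | h + 1 => if hh : h < L then
      pathStep (isLeft J h)
        (if isLeft J h then φ (pathSplit J h hh) else 1 - φ (pathSplit J h hh))
        (pathCDF J x₀ φ h)
    else 0

lemma measurable_pathCDF {L : ℕ} (J : Fin (2 ^ L)) (x₀ : ℝ) (h : ℕ) :
    Measurable fun φ : Split L → ℝ => pathCDF J x₀ φ h := by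
  induction h with
  | zero => exact measurable_const
  | succ h ih =>
    simp only [pathCDF]
    split_ifs with hh hb
    · exact (measurable_pathStep _).comp ((measurable_pi_apply _).prodMk ih)
    · exact (measurable_pathStep _).comp ((measurable_const.sub (measurable_pi_apply _)).prodMk ih)
    · exact measurable_const

/-- `intervalProb` for natural number indices, with the value `0` outside the tree. -/
noncomputable def natIntervalProb {L : ℕ} (φ : Split L → ℝ) (l q : ℕ) : ℝ :=
  if h : l ≤ L ∧ q < 2 ^ l then intervalProb φ l h.1 ⟨q, h.2⟩ else 0

lemma natIntervalProb_succ {L : ℕ} (φ : Split L → ℝ) {l q : ℕ} (hl : l < L)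
    (hq : q < 2 ^ (l + 1)) (hq' : q / 2 < 2 ^ l) :
    natIntervalProb φ (l + 1) q = (if q % 2 = 0 then φ ⟨⟨l, hl⟩, ⟨q / 2, hq'⟩⟩
      else 1 - φ ⟨⟨l, hl⟩, ⟨q / 2, hq'⟩⟩) * natIntervalProb φ l (q / 2) := by
  rw [natIntervalProb, natIntervalProb, dif_pos ⟨hl, hq⟩, dif_pos ⟨hl.le, hq'⟩]
  rfl

lemma natIntervalProb_children {L : ℕ} (φ : Split L → ℝ) {l q : ℕ} (hl : l < L) (hq : q < 2 ^ l) :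
    natIntervalProb φ (l + 1) (2 * q) + natIntervalProb φ (l + 1) (2 * q + 1) =
      natIntervalProb φ l q := by
  have e : (2 * q + 1) / 2 = q := by omega
  have e' : 2 * q / 2 = q := by omega
  rw [natIntervalProb_succ φ hl (by rw [pow_succ]; omega) (by omega),
    natIntervalProb_succ φ hl (by rw [pow_succ]; omega) (by omega)]
  simp only [e, e', Nat.mul_mod_right, if_true, show ¬ (2 * q + 1) % 2 = 0 by omega, if_false]
  ring

lemma sum_natIntervalProb_children {L : ℕ} (φ : Split L → ℝ) {l : ℕ} (hl : l < L) {q : ℕ}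
    (hq : q ≤ 2 ^ l) :
    ∑ i ∈ Finset.range (2 * q), natIntervalProb φ (l + 1) i =
      ∑ i ∈ Finset.range q, natIntervalProb φ l i := by
  induction q with
  | zero => simp
  | succ q ih =>
    rw [show 2 * (q + 1) = 2 * q + 1 + 1 by ring, Finset.sum_range_succ, Finset.sum_range_succ,
      Finset.sum_range_succ, ih (by omega), add_assoc, natIntervalProb_children φ hl (by omega)]

lemma sum_natIntervalProb_add_pathCDF {L : ℕ} (J : Fin (2 ^ L)) (x₀ : ℝ) (φ : Split L → ℝ)
    (h l : ℕ) (hl : h + l = L) :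
    ∑ i ∈ Finset.range ((J : ℕ) / 2 ^ h), natIntervalProb φ l i +
        natIntervalProb φ l ((J : ℕ) / 2 ^ h) * pathCDF J x₀ φ h =
      ∑ i ∈ Finset.range (J : ℕ), natIntervalProb φ L i + natIntervalProb φ L J * x₀ := by
  induction h generalizing l with
  | zero =>
    obtain rfl : l = L := by omega
    simp [pathCDF]
  | succ h ih =>
    rw [← ih (l + 1) (by omega)]
    have hlt : l < L := by omega
    have hJ : (J : ℕ) / 2 ^ h < 2 ^ (l + 1) := by
      refine Nat.div_lt_of_lt_mul ?_
      rw [← pow_add, show h + (l + 1) = L by omega]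
      exact J.isLt
    have hdiv : (J : ℕ) / 2 ^ (h + 1) = (J : ℕ) / 2 ^ h / 2 := by
      rw [Nat.div_div_eq_div_mul, pow_succ]
    have hJ' : (J : ℕ) / 2 ^ h / 2 < 2 ^ l := by
      rw [pow_succ] at hJ; omega
    have hs : pathSplit J h (by omega) = ⟨⟨l, hlt⟩, ⟨(J : ℕ) / 2 ^ h / 2, hJ'⟩⟩ :=
      split_ext (by simp only [pathSplit]; omega) (by simp only [pathSplit]; exact hdiv)
    rw [pathCDF, dif_pos (by omega : h < L), hs, hdiv, natIntervalProb_succ φ hlt hJ hJ']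
    have hsum := sum_natIntervalProb_children φ hlt (q := (J : ℕ) / 2 ^ h / 2) hJ'.le
    rcases Nat.mod_two_eq_zero_or_one ((J : ℕ) / 2 ^ h) with hm | hm
    · have hb : isLeft J h = true := by simp [isLeft, hm]
      rw [show 2 * ((J : ℕ) / 2 ^ h / 2) = (J : ℕ) / 2 ^ h by omega] at hsum
      rw [hsum, hb, if_pos hm, if_pos rfl]
      simp only [pathStep, if_true]
      ring
    · have hb : isLeft J h = false := by simp [isLeft, hm]
      have e : (J : ℕ) / 2 ^ h = 2 * ((J : ℕ) / 2 ^ h / 2) + 1 := by omega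
      have hl := natIntervalProb_succ φ hlt (q := 2 * ((J : ℕ) / 2 ^ h / 2))
        (by rw [pow_succ]; omega) (by omega)
      simp only [show 2 * ((J : ℕ) / 2 ^ h / 2) / 2 = (J : ℕ) / 2 ^ h / 2 by omega,
        Nat.mul_mod_right, if_true] at hl
      have hsum' : ∑ i ∈ Finset.range ((J : ℕ) / 2 ^ h), natIntervalProb φ (l + 1) i =
          ∑ i ∈ Finset.range ((J : ℕ) / 2 ^ h / 2), natIntervalProb φ l i +
            φ ⟨⟨l, hlt⟩, ⟨(J : ℕ) / 2 ^ h / 2, hJ'⟩⟩ *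
              natIntervalProb φ l ((J : ℕ) / 2 ^ h / 2) := by
        conv_lhs => rw [e]
        rw [Finset.sum_range_succ, hsum, hl]
      rw [hsum', hb, if_neg (show ¬ (J : ℕ) / 2 ^ h % 2 = 0 by omega)]
      simp only [pathStep, Bool.false_eq_true, if_false]
      ring

/-- The distribution function at a point of the leaf `J` is the conditional distribution function
of the root. -/
lemma sum_leafProb_add {L : ℕ} (J : Fin (2 ^ L)) (x₀ : ℝ) (φ : Split L → ℝ) :
    (∑ i : Fin (2 ^ L), if (i : ℕ) < J then leafProb φ i else 0) + leafProb φ J * x₀ =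
      pathCDF J x₀ φ L := by
  have key := sum_natIntervalProb_add_pathCDF J x₀ φ L 0 (by omega)
  have hleaf : ∀ i : Fin (2 ^ L), natIntervalProb φ L i = leafProb φ i := fun i =>
    dif_pos ⟨le_rfl, i.isLt⟩
  rw [Nat.div_eq_of_lt J.isLt] at key
  have h0 : natIntervalProb φ 0 0 = 1 := by simp [natIntervalProb, intervalProb]
  rw [Finset.range_zero, Finset.sum_empty, h0, zero_add, one_mul] at key
  rw [key, hleaf]
  congr 1
  have : ∀ i : Fin (2 ^ L), (if (i : ℕ) < J then leafProb φ i else 0) =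
      (fun i : ℕ => if i < J then natIntervalProb φ L i else 0) i := fun i => by
    simp only [hleaf]
  rw [Finset.sum_congr rfl fun i _ => this i, Fin.sum_univ_eq_sum_range
    (fun i : ℕ => if i < J then natIntervalProb φ L i else 0), ← Finset.sum_filter]
  refine Finset.sum_congr ?_ fun _ _ => rfl
  ext i
  simp only [Finset.mem_filter, Finset.mem_range]
  have := J.isLt
  omega

lemma pathCDF_update {L : ℕ} (J : Fin (2 ^ L)) (x₀ : ℝ) (φ : Split L → ℝ) {h h' : ℕ}
    (hh : h' < L) (hle : h ≤ h') (y : ℝ) :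
    pathCDF J x₀ (Function.update φ (pathSplit J h' hh) y) h = pathCDF J x₀ φ h := by
  induction h with
  | zero => rfl
  | succ h ih =>
    have hne : pathSplit J h (by omega) ≠ pathSplit J h' hh := by
      intro heq
      have : L - 1 - h = L - 1 - h' := congrArg (fun s : Split L => (s.1 : ℕ)) heq
      omega
    simp only [pathCDF, show h < L by omega, dif_pos, Function.update_of_ne hne,
      ih (by omega)]

/-- Under independent Beta splits whose parameters on the path are given by the counts `c`, the
conditional distribution functions along the path follow `pathLaw`. -/
lemma lintegral_pathCDF {L : ℕ} (J : Fin (2 ^ L)) (x₀ : ℝ) (c : ℕ → ℕ) {α β : Split L → ℝ}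
    (hα : ∀ s, 0 < α s) (hβ : ∀ s, 0 < β s)
    (hleft : ∀ h (hh : h < L), isLeft J h = true →
      α (pathSplit J h hh) = 1 + nodeCount c h ∧ β (pathSplit J h hh) = 1 + c (h + 1))
    (hright : ∀ h (hh : h < L), isLeft J h = false →
      α (pathSplit J h hh) = 1 + c (h + 1) ∧ β (pathSplit J h hh) = 1 + nodeCount c h)
    {h : ℕ} (hh : h ≤ L) {f : ℝ → ℝ≥0∞} (hf : Measurable f) :
    ∫⁻ φ, f (pathCDF J x₀ φ h) ∂Measure.pi (fun s => betaMeasure (α s) (β s)) =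
      ∫⁻ y, f y ∂pathLaw (isLeft J) x₀ c h := by
  have : ∀ s, IsProbabilityMeasure (betaMeasure (α s) (β s)) := fun s =>
    isProbabilityMeasureBeta (hα s) (hβ s)
  induction h generalizing f with
  | zero => simp [pathCDF, pathLaw, lintegral_dirac]
  | succ h ih =>
    have hh' : h < L := by omega
    have : IsProbabilityMeasure (betaMeasure (1 + nodeCount c h) (1 + c (h + 1))) :=
      isProbabilityMeasureBeta (by positivity) (by positivity)
    set s := pathSplit J h hh' with hs
    have hstep : Measurable fun z : ℝ × ℝ => f (pathStep (isLeft J h) z.1 z.2) :=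
      hf.comp (measurable_pathStep _)
    have hK : Measurable fun z => ∫⁻ ψ, f (pathStep (isLeft J h) ψ z)
        ∂betaMeasure (1 + nodeCount c h) (1 + c (h + 1)) :=
      measurable_lintegral_pathStep (F := fun z ψ => pathStep (isLeft J h) ψ z) hf
        ((measurable_pathStep _).comp measurable_swap)
    rw [lintegral_pi_update _ s (f := fun φ => f (pathCDF J x₀ φ (h + 1)))
        (hf.comp (measurable_pathCDF J x₀ (h + 1))),
      lintegral_pathLaw_succ _ _ _ _ hf,
      lintegral_lintegral_swap (f := fun ψ y => f (pathStep (isLeft J h) ψ y))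
        hstep.aemeasurable,
      ← ih (by omega) hK]
    refine lintegral_congr fun φ => ?_
    simp only [pathCDF, hh', dif_pos, ← hs, Function.update_self]
    have hupd : ∀ y, pathCDF J x₀ (Function.update φ s y) h = pathCDF J x₀ φ h := fun y =>
      pathCDF_update J x₀ φ hh' le_rfl y
    simp_rw [hupd]
    cases hb : isLeft J h with
    | true =>
      obtain ⟨h1, h2⟩ := hleft h hh' hb
      simp [hs, h1, h2]
    | false =>
      obtain ⟨h1, h2⟩ := hright h hh' hb
      rw [← hs] at h1 h2
      simp only [h1, h2, Bool.false_eq_true, if_false]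
      exact lintegral_betaMeasure_one_sub (by positivity) (by positivity)
        (f := fun ψ => f (pathStep false ψ (pathCDF J x₀ φ h)))
        (hf.comp ((measurable_pathStep false).comp (measurable_id.prodMk measurable_const)))

/-! ### Allocating observations to the siblings of a path -/

/-- The height of the lowest node that contains both the leaves `i` and `J`. -/
def splitHeight (J i : ℕ) : ℕ :=
  Nat.find (p := fun m => i / 2 ^ m = J / 2 ^ m) ⟨i + J, by
    rw [Nat.div_eq_of_lt, Nat.div_eq_of_lt]
    · exact lt_of_le_of_lt (Nat.le_add_left J i) Nat.lt_two_pow_self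
    · exact lt_of_le_of_lt (Nat.le_add_right i J) Nat.lt_two_pow_self⟩

lemma splitHeight_le_iff {J i h : ℕ} : splitHeight J i ≤ h ↔ i / 2 ^ h = J / 2 ^ h := by
  constructor
  · intro hle
    have hspec : i / 2 ^ splitHeight J i = J / 2 ^ splitHeight J i :=
      Nat.find_spec (p := fun m => i / 2 ^ m = J / 2 ^ m) _
    obtain ⟨d, rfl⟩ := Nat.exists_eq_add_of_le hle
    rw [pow_add, ← Nat.div_div_eq_div_mul, hspec, Nat.div_div_eq_div_mul]
  · exact fun h => Nat.find_min' _ h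

lemma splitHeight_le {L : ℕ} (J i : Fin (2 ^ L)) : splitHeight J i ≤ L := by
  rw [splitHeight_le_iff, Nat.div_eq_of_lt i.isLt, Nat.div_eq_of_lt J.isLt]

lemma div_two_pow_succ (i h : ℕ) : i / 2 ^ (h + 1) = i / 2 ^ h / 2 := by
  rw [Nat.div_div_eq_div_mul, pow_succ]

/-- Moving one observation to the right decreases the distribution function at the marked point. -/
lemma pathLaw_addObs_splitHeight_le {L : ℕ} (J : Fin (2 ^ L)) {x₀ : ℝ}
    (hx₀ : x₀ ∈ Icc (0 : ℝ) 1) (c : ℕ → ℕ) {i i' : Fin (2 ^ L)} (hi : i ≤ i') :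
    IncreasingLE (pathLaw (isLeft J) x₀ (addObs c (splitHeight J i')) L)
      (pathLaw (isLeft J) x₀ (addObs c (splitHeight J i)) L) := by
  have hle : ∀ h, (i : ℕ) / 2 ^ h ≤ (i' : ℕ) / 2 ^ h := fun h => Nat.div_le_div_right hi
  have hL := splitHeight_le J i
  have hL' := splitHeight_le J i'
  rcases lt_trichotomy (splitHeight J i) (splitHeight J i') with hlt | heq | hgt
  · obtain ⟨k, hk⟩ : ∃ k, splitHeight J i' = k + 1 := ⟨splitHeight J i' - 1, by omega⟩
    rw [hk]
    refine pathLaw_addObs_le_of_left _ hx₀ c (by omega) ?_ (by omega)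
    have h1 := splitHeight_le_iff.1 (show splitHeight J i ≤ k by omega)
    have h2 := mt splitHeight_le_iff.2 (show ¬ splitHeight J i' ≤ k by omega)
    have h3 := splitHeight_le_iff.1 hk.le
    have h4 := hle k
    rw [div_two_pow_succ, div_two_pow_succ] at h3
    simp only [isLeft, decide_eq_true_eq]
    omega
  · rw [heq]
    exact IncreasingLE.refl _
  · obtain ⟨k, hk⟩ : ∃ k, splitHeight J i = k + 1 := ⟨splitHeight J i - 1, by omega⟩
    rw [hk]
    refine pathLaw_addObs_le_of_right _ hx₀ c (by omega) ?_ (by omega)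
    have h1 := splitHeight_le_iff.1 (show splitHeight J i' ≤ k by omega)
    have h2 := mt splitHeight_le_iff.2 (show ¬ splitHeight J i ≤ k by omega)
    have h3 := splitHeight_le_iff.1 hk.le
    have h4 := hle k
    rw [div_two_pow_succ, div_two_pow_succ] at h3
    simp only [isLeft, decide_eq_false_iff_not]
    omega

/-- The numbers of observations in the leaf `J` and in the siblings of the nodes above it, for
observations allocated to leaves by `i`. -/
def obsCount {L K : ℕ} (J : Fin (2 ^ L)) (i : Fin K → Fin (2 ^ L)) : ℕ → ℕ :=
  ∑ k, Pi.single (splitHeight J (i k)) 1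

/-- Moving observations to the right decreases the distribution function at the marked point. -/
lemma pathLaw_obsCount_le {L K : ℕ} (J : Fin (2 ^ L)) {x₀ : ℝ} (hx₀ : x₀ ∈ Icc (0 : ℝ) 1)
    {i i' : Fin K → Fin (2 ^ L)} (hi : i ≤ i') :
    IncreasingLE (pathLaw (isLeft J) x₀ (obsCount J i') L)
      (pathLaw (isLeft J) x₀ (obsCount J i) L) := by
  have key : ∀ (T : Finset (Fin K)) (c : ℕ → ℕ), IncreasingLE
      (pathLaw (isLeft J) x₀ (c + ∑ k ∈ T, Pi.single (splitHeight J (i' k)) 1) L)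
      (pathLaw (isLeft J) x₀ (c + ∑ k ∈ T, Pi.single (splitHeight J (i k)) 1) L) := by
    intro T
    induction T using Finset.induction_on with
    | empty => exact fun c => by simpa using IncreasingLE.refl _
    | insert k T hk ih =>
      intro c
      rw [Finset.sum_insert hk, Finset.sum_insert hk, ← add_assoc]
      refine (ih _).trans ?_
      have := pathLaw_addObs_splitHeight_le J hx₀
        (c + ∑ k ∈ T, Pi.single (splitHeight J (i k)) 1) (hi k)
      simp only [addObs] at this
      rw [add_right_comm c (Pi.single (splitHeight J (i' k)) 1),
        ← add_assoc,
        add_right_comm c (Pi.single (splitHeight J (i k)) 1)]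
      exact this
  simpa [obsCount] using key Finset.univ 0

lemma obsCount_apply {L K : ℕ} (J : Fin (2 ^ L)) (i : Fin K → Fin (2 ^ L)) (m : ℕ) :
    obsCount J i m = (Finset.univ.filter fun k => splitHeight J (i k) = m).card := by
  simp only [obsCount, Finset.sum_apply, Pi.single_apply, Finset.card_filter]
  exact Finset.sum_congr rfl fun k _ => if_congr eq_comm rfl rfl

lemma nodeCount_obsCount {L K : ℕ} (J : Fin (2 ^ L)) (i : Fin K → Fin (2 ^ L)) (h : ℕ) :
    nodeCount (obsCount J i) h =
      (Finset.univ.filter fun k => (i k : ℕ) / 2 ^ h = (J : ℕ) / 2 ^ h).card := by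
  simp only [nodeCount, obsCount_apply, Finset.card_filter]
  rw [Finset.sum_comm]
  refine Finset.sum_congr rfl fun k _ => ?_
  rw [Finset.sum_ite_eq]
  simp only [Finset.mem_range, Nat.lt_succ_iff, splitHeight_le_iff]

lemma obsCount_succ {L K : ℕ} (J : Fin (2 ^ L)) (i : Fin K → Fin (2 ^ L)) (h : ℕ) :
    obsCount J i (h + 1) = (Finset.univ.filter fun k =>
      (i k : ℕ) / 2 ^ (h + 1) = (J : ℕ) / 2 ^ (h + 1) ∧
        ¬ (i k : ℕ) / 2 ^ h = (J : ℕ) / 2 ^ h).card := by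
  rw [obsCount_apply]
  congr 1
  refine Finset.filter_congr fun k _ => ?_
  rw [← splitHeight_le_iff, ← splitHeight_le_iff]
  omega

lemma leftCount_pathSplit {L K : ℕ} (J : Fin (2 ^ L)) (i : Fin K → Fin (2 ^ L)) {h : ℕ}
    (hh : h < L) : leftCount i (pathSplit J h hh) =
      if isLeft J h then nodeCount (obsCount J i) h else obsCount J i (h + 1) := by
  have e : L - (L - 1 - h) = h + 1 := by omega
  have hdef : leftCount i (pathSplit J h hh) = (Finset.univ.filter fun k =>
      (i k : ℕ) / 2 ^ (h + 1) = (J : ℕ) / 2 ^ (h + 1) ∧ (i k : ℕ) / 2 ^ h % 2 = 0).card := by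
    simp [leftCount, pathSplit, e]
  rw [hdef, nodeCount_obsCount, obsCount_succ]
  simp only [isLeft, decide_eq_true_eq, div_two_pow_succ]
  split_ifs with hb
  all_goals
    congr 1
    refine Finset.filter_congr fun k _ => ?_
    omega

lemma rightCount_pathSplit {L K : ℕ} (J : Fin (2 ^ L)) (i : Fin K → Fin (2 ^ L)) {h : ℕ}
    (hh : h < L) : rightCount i (pathSplit J h hh) =
      if isLeft J h then obsCount J i (h + 1) else nodeCount (obsCount J i) h := by
  have e : L - (L - 1 - h) = h + 1 := by omega
  have hdef : rightCount i (pathSplit J h hh) = (Finset.univ.filter fun k =>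
      (i k : ℕ) / 2 ^ (h + 1) = (J : ℕ) / 2 ^ (h + 1) ∧ ¬ (i k : ℕ) / 2 ^ h % 2 = 0).card := by
    simp [rightCount, pathSplit, e]
  rw [hdef, nodeCount_obsCount, obsCount_succ]
  simp only [isLeft, decide_eq_true_eq, div_two_pow_succ]
  split_ifs with hb
  all_goals
    congr 1
    refine Finset.filter_congr fun k _ => ?_
    omega

/-- Under uniform priors, the law of the distribution function at the marked point given the leaves
of the observations is `pathLaw`. -/
lemma lintegral_pathCDF_mul_prod_leafProb {L K : ℕ} (J : Fin (2 ^ L)) (x₀ : ℝ)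
    (i : Fin K → Fin (2 ^ L)) :
    ∃ Z : ℝ≥0∞, ∀ f : ℝ → ℝ≥0∞, Measurable f →
      ∫⁻ φ, (∏ k, ENNReal.ofReal (leafProb φ (i k))) * f (pathCDF J x₀ φ L)
        ∂Measure.pi (fun _ : Split L => betaMeasure 1 1) =
      Z * ∫⁻ y, f y ∂pathLaw (isLeft J) x₀ (obsCount J i) L := by
  refine ⟨∏ s, ENNReal.ofReal (beta (1 + leftCount i s) (1 + rightCount i s) / beta 1 1),
    fun f hf => ?_⟩
  rw [lintegral_pi_betaMeasure_leafProb (fun _ => one_pos) (fun _ => one_pos) i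
    (G := fun φ => f (pathCDF J x₀ φ L)) (hf.comp (measurable_pathCDF J x₀ L)),
    ← lintegral_pathCDF J x₀ (obsCount J i) (α := fun s => 1 + leftCount i s)
      (β := fun s => 1 + rightCount i s) (fun s => by positivity) (fun s => by positivity)
      (fun h hh hb => ?_) (fun h hh hb => ?_) le_rfl hf]
  · simp [leftCount_pathSplit, rightCount_pathSplit, hb]
  · simp [leftCount_pathSplit, rightCount_pathSplit, hb]

/-! ### Integrating over the hierarchical model -/

lemma measurable_binomial_sigmoid_singleton (n : ℕ) :
    Measurable fun z : ℝ × ℕ => binomial n (unitInterval.sigmoid z.1) {z.2} := by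
  refine measurable_from_prod_countable_left fun k => ?_
  simp only [binomial_singleton]
  have h : Measurable fun t : ℝ => (unitInterval.sigmoid t : ℝ) :=
    (continuous_subtype_val.comp unitInterval.continuous_sigmoid).measurable
  fun_prop

lemma measurable_stepDensity {L : ℕ} (a : Fin (2 ^ L + 1) → ℝ) :
    Measurable fun z : (Fin (2 ^ L) → ℝ) × ℝ => stepDensity a z.1 z.2 := by
  unfold stepDensity
  refine Finset.measurable_fun_sum _ fun i _ => ?_
  refine ((measurable_pi_apply i).comp measurable_fst).mul ?_
  exact (measurable_const.indicator measurableSet_Ioc).comp measurable_snd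

/-- The binomial observations integrate out of the hierarchical model. -/
lemma lintegral_hasLaw_generativeModel {L K : ℕ} {a : Fin (2 ^ L + 1) → ℝ} {α β : Split L → ℝ}
    (hα : ∀ s, 0 < α s) (hβ : ∀ s, 0 < β s) {m : Fin K → ℕ} {Ω : Type*} [MeasurableSpace Ω]
    {P : Measure Ω} {π : Ω → Fin (2 ^ L) → ℝ} {θ : Ω → Fin K → ℝ} {X : Ω → Fin K → ℕ}
    (hlaw : HasLaw (fun ω => (π ω, θ ω, X ω)) (generativeModel a α β m) P)
    {h : (Fin (2 ^ L) → ℝ) → (Fin K → ℝ) → ℝ≥0∞} (hh : Measurable (Function.uncurry h)) :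
    ∫⁻ ω, h (π ω) (θ ω) ∂P = ∫⁻ φ, (∫⁻ t : Fin K → ℝ,
      (∏ k, ENNReal.ofReal (stepDensity a (leafProb φ) (t k))) * h (leafProb φ) t)
        ∂Measure.pi fun s => betaMeasure (α s) (β s) := by
  have : ∀ s, IsProbabilityMeasure (betaMeasure (α s) (β s)) := fun s =>
    isProbabilityMeasureBeta (hα s) (hβ s)
  have hsd := measurable_stepDensity a
  have hD : Measurable fun z : (Fin (2 ^ L) → ℝ) × (Fin K → ℝ) × (Fin K → ℕ) =>
      ∏ k, ENNReal.ofReal (stepDensity a z.1 (z.2.1 k)) *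
        binomial (m k) (unitInterval.sigmoid (z.2.1 k)) {z.2.2 k} := by
    refine Finset.measurable_fun_prod _ fun k _ => ?_
    have h₁ : Measurable fun z : (Fin (2 ^ L) → ℝ) × (Fin K → ℝ) × (Fin K → ℕ) =>
        (z.1, z.2.1 k) := by fun_prop
    have h₂ : Measurable fun z : (Fin (2 ^ L) → ℝ) × (Fin K → ℝ) × (Fin K → ℕ) =>
        (z.2.1 k, z.2.2 k) := by fun_prop
    have h₃ := (hsd.comp h₁).ennreal_ofReal
    have h₄ := (measurable_binomial_sigmoid_singleton (m k)).comp h₂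
    exact h₃.mul h₄
  have hh' : Measurable fun z : (Fin (2 ^ L) → ℝ) × (Fin K → ℝ) × (Fin K → ℕ) => h z.1 z.2.1 :=
    hh.comp (measurable_fst.prodMk (measurable_fst.comp measurable_snd))
  have hmass : ∀ t : Fin K → ℝ, ∑' x : Fin K → ℕ,
      ∏ k, binomial (m k) (unitInterval.sigmoid (t k)) {x k} = 1 := by
    intro t
    have e : ∀ x : Fin K → ℕ, ∏ k, binomial (m k) (unitInterval.sigmoid (t k)) {x k} =
        (Measure.pi fun k => binomial (m k) (unitInterval.sigmoid (t k))) {x} := fun x =>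
      (Measure.pi_singleton _ x).symm
    simp_rw [e]
    have := lintegral_countable'
      (μ := Measure.pi fun k => binomial (m k) (unitInterval.sigmoid (t k))) (fun _ => 1)
    simp only [lintegral_one, measure_univ, one_mul] at this
    exact this.symm
  have hin : ∀ (p : Fin (2 ^ L) → ℝ) (t : Fin K → ℝ), ∫⁻ x : Fin K → ℕ,
      (∏ k, ENNReal.ofReal (stepDensity a p (t k)) *
        binomial (m k) (unitInterval.sigmoid (t k)) {x k}) * h p t ∂Measure.count =
      (∏ k, ENNReal.ofReal (stepDensity a p (t k))) * h p t := by
    intro p t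
    rw [lintegral_count]
    simp_rw [Finset.prod_mul_distrib]
    rw [ENNReal.tsum_mul_right, ENNReal.tsum_mul_left, hmass, mul_one]
  have hfull := hD.mul hh'
  have hPT : Measurable fun z : (Fin (2 ^ L) → ℝ) × (Fin K → ℝ) =>
      (∏ k, ENNReal.ofReal (stepDensity a z.1 (z.2 k))) * h z.1 z.2 := by
    refine Measurable.mul (Finset.measurable_fun_prod _ fun k _ => ?_) hh
    exact (hsd.comp (by fun_prop : Measurable
      fun z : (Fin (2 ^ L) → ℝ) × (Fin K → ℝ) => (z.1, z.2 k))).ennreal_ofReal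
  calc ∫⁻ ω, h (π ω) (θ ω) ∂P
      = ∫⁻ z, h z.1 z.2.1 ∂P.map fun ω => (π ω, θ ω, X ω) :=
        (lintegral_map' hh'.aemeasurable hlaw.aemeasurable).symm
    _ = ∫⁻ p, (∫⁻ t : Fin K → ℝ, (∏ k, ENNReal.ofReal (stepDensity a p (t k))) * h p t)
          ∂fptLaw α β := by
        have : SFinite (fptLaw α β) := by unfold fptLaw; infer_instance
        rw [hlaw.map_eq, generativeModel, lintegral_withDensity_eq_lintegral_mul _ hD hh',
          lintegral_prod _ hfull.aemeasurable]
        refine lintegral_congr fun p => ?_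
        refine (lintegral_prod _ (hfull.comp measurable_prodMk_left).aemeasurable).trans ?_
        exact lintegral_congr fun t => hin p t
    _ = _ := by
        rw [fptLaw, lintegral_map hPT.lintegral_prod_right' (measurable_leafProb L)]

/-- The index of the leaf interval containing `t`, for `t` in the range of the leaf intervals: the
number of leaf intervals to the left of `t`, truncated. -/
noncomputable def leafIndex {L : ℕ} (a : Fin (2 ^ L + 1) → ℝ) (t : ℝ) : Fin (2 ^ L) :=
  ⟨min (Finset.univ.filter fun i : Fin (2 ^ L) => a i.succ < t).card (2 ^ L - 1), by
    have := Nat.two_pow_pos L; omega⟩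

lemma leafIndex_mono {L : ℕ} (a : Fin (2 ^ L + 1) → ℝ) : Monotone (leafIndex a) := by
  intro s t hst
  rw [Fin.le_def]
  refine min_le_min_right _ (Finset.card_le_card fun i => ?_)
  simp only [Finset.mem_filter, Finset.mem_univ, true_and]
  exact fun h => h.trans_le hst

lemma leafIndex_eq {L : ℕ} {a : Fin (2 ^ L + 1) → ℝ} (ha : StrictMono a) {t : ℝ}
    {i : Fin (2 ^ L)} (ht : t ∈ Ioc (a i.castSucc) (a i.succ)) : leafIndex a t = i := by
  have : (Finset.univ.filter fun i' : Fin (2 ^ L) => a i'.succ < t) = Finset.Iio i := by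
    ext i'
    simp only [Finset.mem_filter, Finset.mem_univ, true_and, Finset.mem_Iio]
    constructor
    · intro h
      have := ha.lt_iff_lt.1 (h.trans_le ht.2)
      simpa using this
    · intro h
      refine lt_of_le_of_lt (ha.monotone ?_) ht.1
      rw [Fin.le_def, Fin.val_succ, Fin.val_castSucc]
      exact h
  ext
  simp only [leafIndex, this, Fin.card_Iio]
  have := i.isLt
  omega

lemma measurable_leafIndex {L : ℕ} (a : Fin (2 ^ L + 1) → ℝ) : Measurable (leafIndex a) := by
  have h : Measurable fun t : ℝ =>
      (Finset.univ.filter fun i : Fin (2 ^ L) => a i.succ < t).card := by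
    simp only [Finset.card_filter]
    exact Finset.measurable_fun_sum _ fun i _ =>
      Measurable.ite measurableSet_Ioi measurable_const measurable_const
  have h2 : Measurable fun n : ℕ => (⟨min n (2 ^ L - 1), by
    have := Nat.two_pow_pos L; omega⟩ : Fin (2 ^ L)) := measurable_from_nat
  exact h2.comp h

/-- The density of the leaf interval containing `t` within itself. -/
noncomputable def cellDensity {L : ℕ} (a : Fin (2 ^ L + 1) → ℝ) (t : ℝ) : ℝ :=
  stepDensity a (fun _ => 1) t

lemma cellDensity_nonneg {L : ℕ} {a : Fin (2 ^ L + 1) → ℝ} (ha : StrictMono a) (t : ℝ) :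
    0 ≤ cellDensity a t := by
  unfold cellDensity stepDensity
  refine Finset.sum_nonneg fun i _ => ?_
  have : 0 ≤ 1 / (a i.succ - a i.castSucc) :=
    one_div_nonneg.2 (sub_pos.2 (ha i.castSucc_lt_succ)).le
  rw [one_mul]
  exact indicator_nonneg (fun _ _ => this) t

lemma stepDensity_eq_mul {L : ℕ} {a : Fin (2 ^ L + 1) → ℝ} (ha : StrictMono a)
    (p : Fin (2 ^ L) → ℝ) (t : ℝ) :
    stepDensity a p t = cellDensity a t * p (leafIndex a t) := by
  rw [cellDensity, stepDensity, stepDensity, Finset.sum_mul]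
  refine Finset.sum_congr rfl fun i _ => ?_
  by_cases ht : t ∈ Ioc (a i.castSucc) (a i.succ)
  · rw [leafIndex_eq ha ht]
    ring
  · rw [indicator_of_notMem ht]
    ring

lemma prod_stepDensity {L K : ℕ} {a : Fin (2 ^ L + 1) → ℝ} (ha : StrictMono a)
    (p : Fin (2 ^ L) → ℝ) (t : Fin K → ℝ) :
    ∏ k, ENNReal.ofReal (stepDensity a p (t k)) =
      (∏ k, ENNReal.ofReal (cellDensity a (t k))) *
        ∏ k, ENNReal.ofReal (p (leafIndex a (t k))) := by
  rw [← Finset.prod_mul_distrib]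
  refine Finset.prod_congr rfl fun k _ => ?_
  rw [stepDensity_eq_mul ha, ENNReal.ofReal_mul (cellDensity_nonneg ha _)]

lemma sfinite_map_of_hasLaw_generativeModel {L K : ℕ} {a : Fin (2 ^ L + 1) → ℝ}
    {α β : Split L → ℝ} {m : Fin K → ℕ} (hα : ∀ s, 0 < α s) (hβ : ∀ s, 0 < β s)
    {Ω : Type*} [MeasurableSpace Ω]
    {P : Measure Ω} {π : Ω → Fin (2 ^ L) → ℝ} {θ : Ω → Fin K → ℝ} {X : Ω → Fin K → ℕ}
    (hlaw : HasLaw (fun ω => (π ω, θ ω, X ω)) (generativeModel a α β m) P) :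
    SFinite (P.map θ) := by
  have : ∀ s, IsProbabilityMeasure (betaMeasure (α s) (β s)) := fun s =>
    isProbabilityMeasureBeta (hα s) (hβ s)
  have : SFinite (fptLaw α β) := by unfold fptLaw; infer_instance
  have : SFinite (generativeModel a α β m) := by unfold generativeModel; infer_instance
  have e : P.map θ = (generativeModel a α β m).map fun z => z.2.1 := by
    rw [← hlaw.map_eq, AEMeasurable.map_map_of_aemeasurable
      (by fun_prop) hlaw.aemeasurable]
    rfl
  rw [e]
  infer_instance

/-! ### Monotonicity of the posterior under uniform priors -/

/-- The posterior law of the distribution function at a point of the leaf `J`, as a function of the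
vector of parameters `θ`. -/
noncomputable def posteriorKernel {L : ℕ} (K : ℕ) (a : Fin (2 ^ L + 1) → ℝ) (J : Fin (2 ^ L))
    (x₀ : ℝ) : Kernel (Fin K → ℝ) ℝ :=
  (Kernel.ofFunOfCountable fun i : Fin K → Fin (2 ^ L) =>
    pathLaw (isLeft J) x₀ (obsCount J i) L).comap (fun t k => leafIndex a (t k))
      (measurable_pi_lambda _ fun k => (measurable_leafIndex a).comp (measurable_pi_apply k))

lemma posteriorKernel_apply {L K : ℕ} (a : Fin (2 ^ L + 1) → ℝ) (J : Fin (2 ^ L)) (x₀ : ℝ)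
    (t : Fin K → ℝ) : posteriorKernel K a J x₀ t =
      pathLaw (isLeft J) x₀ (obsCount J fun k => leafIndex a (t k)) L := rfl

instance isMarkovKernel_posteriorKernel {L K : ℕ} (a : Fin (2 ^ L + 1) → ℝ) (J : Fin (2 ^ L))
    (x₀ : ℝ) : IsMarkovKernel (posteriorKernel K a J x₀) :=
  ⟨fun t => by rw [posteriorKernel_apply]; infer_instance⟩

lemma hasCondDistrib_posteriorKernel {L K : ℕ} {a : Fin (2 ^ L + 1) → ℝ} (ha : StrictMono a)
    {m : Fin K → ℕ} {Ω : Type*} [MeasurableSpace Ω]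
    {P : Measure Ω} {π : Ω → Fin (2 ^ L) → ℝ} {θ : Ω → Fin K → ℝ} {X : Ω → Fin K → ℕ}
    (hlaw : HasLaw (fun ω => (π ω, θ ω, X ω)) (generativeModel a (fun _ => 1) (fun _ => 1) m) P)
    (J : Fin (2 ^ L)) (x₀ : ℝ) :
    HasCondDistrib (fun ω => (∑ i : Fin (2 ^ L), if (i : ℕ) < J then π ω i else 0) + π ω J * x₀) θ
      (posteriorKernel K a J x₀) P := by
  set F : (Fin (2 ^ L) → ℝ) → ℝ := fun p =>
    (∑ i : Fin (2 ^ L), if (i : ℕ) < J then p i else 0) + p J * x₀ with hF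
  have hFm : Measurable F := by
    refine Measurable.add (Finset.measurable_fun_sum _ fun i _ => ?_) (by fun_prop)
    split_ifs
    · exact measurable_pi_apply i
    · exact measurable_const
  have hπ : AEMeasurable π P := hlaw.aemeasurable.fst
  have hθ : AEMeasurable θ P := hlaw.aemeasurable.snd.fst
  have hpair : AEMeasurable (fun ω => (θ ω, F (π ω))) P :=
    hθ.prodMk (hFm.comp_aemeasurable hπ)
  have := isProbabilityMeasureBeta one_pos one_pos
  have := sfinite_map_of_hasLaw_generativeModel (fun _ => one_pos) (fun _ => one_pos) hlaw
  set κ := posteriorKernel K a J x₀ with hκ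
  choose Z hZ using fun i : Fin K → Fin (2 ^ L) => lintegral_pathCDF_mul_prod_leafProb J x₀ i
  -- Both integrals have the form of an integral over the allocation of observations to leaves.
  have key : ∀ H : (Fin K → ℝ) → ℝ → ℝ≥0∞, Measurable (Function.uncurry H) →
      ∫⁻ ω, H (θ ω) (F (π ω)) ∂P = ∫⁻ t : Fin K → ℝ,
        (∏ k, ENNReal.ofReal (cellDensity a (t k))) * (Z (fun k => leafIndex a (t k)) *
          ∫⁻ y, H t y ∂κ t) := by
    intro H hH
    have hHF : Measurable (Function.uncurry fun p t => H t (F p)) :=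
      hH.comp (measurable_snd.prodMk (hFm.comp measurable_fst))
    rw [lintegral_hasLaw_generativeModel (h := fun p t => H t (F p)) (fun _ => one_pos)
      (fun _ => one_pos) hlaw hHF, lintegral_lintegral_swap]
    · refine lintegral_congr fun t => ?_
      rw [hκ, posteriorKernel_apply, ← hZ _ (H t) (hH.comp measurable_prodMk_left),
        ← lintegral_const_mul']
      · refine lintegral_congr fun φ => ?_
        rw [prod_stepDensity ha, mul_assoc]
        simp only [hF, sum_leafProb_add]
      · exact ENNReal.prod_ne_top fun _ _ => ENNReal.ofReal_ne_top
    · have hl := measurable_leafProb L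
      refine (Measurable.mul (Finset.measurable_fun_prod _ fun k _ => ?_) ?_).aemeasurable
      · exact ((measurable_stepDensity a).comp (by fun_prop : Measurable
          fun z : (Split L → ℝ) × (Fin K → ℝ) => (leafProb z.1, z.2 k))).ennreal_ofReal
      · exact hHF.comp ((hl.comp measurable_fst).prodMk measurable_snd)
  refine ⟨hpair, ?_⟩
  ext s hs
  have hsH : Measurable (Function.uncurry fun (t : Fin K → ℝ) (y : ℝ) =>
      s.indicator (1 : (Fin K → ℝ) × ℝ → ℝ≥0∞) (t, y)) := measurable_one.indicator hs
  have hκs : Measurable fun t => κ t (Prod.mk t ⁻¹' s) := Kernel.measurable_kernel_prodMk_left hs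
  rw [Measure.compProd_apply hs, lintegral_map' hκs.aemeasurable hθ,
    ← lintegral_indicator_one hs, lintegral_map' (measurable_one.indicator hs).aemeasurable hpair,
    key _ hsH, key (fun t _ => κ t (Prod.mk t ⁻¹' s)) (hκs.comp measurable_fst)]
  refine lintegral_congr fun t => ?_
  rw [lintegral_const, measure_univ, mul_one,
    ← lintegral_indicator_one (measurable_prodMk_left hs)]
  rfl

/-- The endpoints of the leaf intervals are marked points of leaves. -/
lemma exists_mixingCDF_endpoint {L : ℕ} {a : Fin (2 ^ L + 1) → ℝ} (ha : StrictMono a)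
    (j : Fin (2 ^ L + 1)) : ∃ J : Fin (2 ^ L), ∃ x₀ ∈ Icc (0 : ℝ) 1, ∀ p : Fin (2 ^ L) → ℝ,
      mixingCDF a p (a j) = (∑ i : Fin (2 ^ L), if (i : ℕ) < J then p i else 0) + p J * x₀ := by
  rcases Nat.lt_or_ge j (2 ^ L) with hj | hj
  · refine ⟨⟨j, hj⟩, 0, by simp, fun p => ?_⟩
    rw [mixingCDF_apply_endpoint a ha, mul_zero, add_zero]
  · -- The last endpoint is the right end of the last leaf.
    have hpos := Nat.two_pow_pos L
    refine ⟨⟨2 ^ L - 1, by omega⟩, 1, by simp, fun p => ?_⟩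
    have e : ∀ i : Fin (2 ^ L), (if (i : ℕ) < (j : ℕ) then p i else 0) =
        (if (i : ℕ) < 2 ^ L - 1 then p i else 0) +
          if i = ⟨2 ^ L - 1, by omega⟩ then p i else 0 := by
      intro i
      have hi := i.isLt
      rw [if_pos (by omega)]
      by_cases h : (i : ℕ) < 2 ^ L - 1
      · rw [if_pos h, if_neg (fun h' => by simp [h'] at h), add_zero]
      · rw [if_neg h, if_pos (Fin.ext (by simp only; omega)), zero_add]
    rw [mixingCDF_apply_endpoint a ha, Finset.sum_congr rfl fun i _ => e i,
      Finset.sum_add_distrib, Finset.sum_ite_eq' Finset.univ, if_pos (Finset.mem_univ _), mul_one]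

lemma condStochDecreasing_of_uniform {L K : ℕ} {a : Fin (2 ^ L + 1) → ℝ} (ha : StrictMono a)
    {m : Fin K → ℕ} {Ω : Type*} [MeasurableSpace Ω]
    {P : Measure Ω} {π : Ω → Fin (2 ^ L) → ℝ} {θ : Ω → Fin K → ℝ} {X : Ω → Fin K → ℕ}
    (hlaw : HasLaw (fun ω => (π ω, θ ω, X ω)) (generativeModel a (fun _ => 1) (fun _ => 1) m) P)
    (j : Fin (2 ^ L + 1)) :
    CondStochDecreasing P (fun ω => mixingCDF a (π ω) (a j)) θ (thetaRange K a) := by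
  obtain ⟨J, x₀, hx₀, hJ⟩ := exists_mixingCDF_endpoint ha j
  refine ⟨posteriorKernel K a J x₀, inferInstance, ?_, fun s _ t _ hst => ?_⟩
  · simp_rw [hJ]
    exact hasCondDistrib_posteriorKernel ha hlaw J x₀
  · rw [posteriorKernel_apply, posteriorKernel_apply]
    exact (pathLaw_obsCount_le J hx₀ fun k => leafIndex_mono a (hst k)).stochLE

/-! ### The counterexample for unequal hyper-parameters -/

/-- The leaf interval with index `c`. -/
def leafCell {L : ℕ} (a : Fin (2 ^ L + 1) → ℝ) (c : Fin (2 ^ L)) : Set ℝ :=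
  Ioc (a c.castSucc) (a c.succ)

lemma measurableSet_leafCell {L : ℕ} (a : Fin (2 ^ L + 1) → ℝ) (c : Fin (2 ^ L)) :
    MeasurableSet (leafCell a c) := measurableSet_Ioc

/-- The event that a single parameter lies in the leaf interval with index `c`. -/
def leafEvent {L : ℕ} (a : Fin (2 ^ L + 1) → ℝ) (c : Fin (2 ^ L)) : Set (Fin 1 → ℝ) :=
  (fun t => t 0) ⁻¹' leafCell a c

lemma measurableSet_leafEvent {L : ℕ} (a : Fin (2 ^ L + 1) → ℝ) (c : Fin (2 ^ L)) :
    MeasurableSet (leafEvent a c) :=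
  measurable_pi_apply 0 (measurableSet_leafCell a c)

lemma lintegral_stepDensity_leafCell {L : ℕ} {a : Fin (2 ^ L + 1) → ℝ} (ha : StrictMono a)
    (p : Fin (2 ^ L) → ℝ) (c : Fin (2 ^ L)) :
    ∫⁻ x in leafCell a c, ENNReal.ofReal (stepDensity a p x) = ENNReal.ofReal (p c) := by
  have hpos : 0 < a c.succ - a c.castSucc := sub_pos.2 (ha c.castSucc_lt_succ)
  have e : EqOn (fun x => ENNReal.ofReal (stepDensity a p x))
      (fun _ => ENNReal.ofReal (p c * (1 / (a c.succ - a c.castSucc)))) (leafCell a c) := by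
    intro x hx
    simp only
    congr 1
    rw [stepDensity, Finset.sum_eq_single c]
    · rw [indicator_of_mem (show x ∈ Ioc _ _ from hx)]
    · intro i _ hi
      rw [indicator_of_notMem, mul_zero]
      intro hx'
      exact hi ((leafIndex_eq ha hx').symm.trans (leafIndex_eq ha hx))
    · simp
  rw [setLIntegral_congr_fun (measurableSet_leafCell a c) e, setLIntegral_const, leafCell,
    Real.volume_Ioc,
    ← ENNReal.ofReal_mul' hpos.le, mul_assoc, one_div_mul_cancel hpos.ne', mul_one]

/-- With a single observation, restricting to the event that it falls in the leaf interval `c`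
amounts to reweighting by the probability of this leaf. -/
lemma lintegral_hasLaw_leafCell {L : ℕ} {a : Fin (2 ^ L + 1) → ℝ} (ha : StrictMono a)
    {α β : Split L → ℝ} (hα : ∀ s, 0 < α s) (hβ : ∀ s, 0 < β s) {m : Fin 1 → ℕ} {Ω : Type*}
    [MeasurableSpace Ω] {P : Measure Ω} {π : Ω → Fin (2 ^ L) → ℝ} {θ : Ω → Fin 1 → ℝ}
    {X : Ω → Fin 1 → ℕ} (hlaw : HasLaw (fun ω => (π ω, θ ω, X ω)) (generativeModel a α β m) P)
    (c : Fin (2 ^ L)) {g : (Fin (2 ^ L) → ℝ) → ℝ≥0∞} (hg : Measurable g) :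
    ∫⁻ ω, (leafEvent a c).indicator (fun _ => g (π ω)) (θ ω) ∂P =
      ∫⁻ φ, ENNReal.ofReal (leafProb φ c) * g (leafProb φ)
        ∂Measure.pi fun s => betaMeasure (α s) (β s) := by
  have hcell := measurableSet_leafEvent a c
  have hh : Measurable (Function.uncurry fun (p : Fin (2 ^ L) → ℝ) (t : Fin 1 → ℝ) =>
      (leafEvent a c).indicator (fun _ => g p) t) :=
    (hg.comp measurable_fst).indicator (measurable_snd hcell)
  rw [lintegral_hasLaw_generativeModel hα hβ hlaw hh]
  refine lintegral_congr fun φ => ?_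
  have hmp := volume_preserving_funUnique (Fin 1) ℝ
  have hfm : Measurable ((leafCell a c).indicator
      fun x => ENNReal.ofReal (stepDensity a (leafProb φ) x)) :=
    ((measurable_stepDensity a).comp measurable_prodMk_left).ennreal_ofReal.indicator
      (measurableSet_leafCell a c)
  have hf : Measurable fun x : ℝ => (leafCell a c).indicator
      (fun x => ENNReal.ofReal (stepDensity a (leafProb φ) x)) x * g (leafProb φ) := by
    exact hfm.mul_const _
  calc _ = ∫⁻ t : Fin 1 → ℝ, (leafCell a c).indicator
        (fun x => ENNReal.ofReal (stepDensity a (leafProb φ) x)) (t 0) * g (leafProb φ) := by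
        refine lintegral_congr fun t => ?_
        rw [Fin.prod_univ_one]
        by_cases ht : t 0 ∈ leafCell a c
        · rw [indicator_of_mem ht, indicator_of_mem (show t ∈ leafEvent a c from ht)]
        · rw [indicator_of_notMem ht, indicator_of_notMem (show t ∉ leafEvent a c from ht),
            mul_zero, zero_mul]
    _ = ∫⁻ x, (leafCell a c).indicator
        (fun x => ENNReal.ofReal (stepDensity a (leafProb φ) x)) x * g (leafProb φ) :=
        hmp.lintegral_comp hf
    _ = _ := by
        rw [lintegral_mul_const _ hfm, lintegral_indicator (measurableSet_leafCell a c),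
          lintegral_stepDensity_leafCell ha]

/-- Stochastically ordered laws on the real line have ordered means of positive parts. -/
lemma StochLE.lintegral_ofReal_le {μ ν : Measure ℝ} (h : StochLE μ ν) :
    ∫⁻ y, ENNReal.ofReal y ∂μ ≤ ∫⁻ y, ENNReal.ofReal y ∂ν := by
  have e : ∀ ρ : Measure ℝ, ∫⁻ y, ENNReal.ofReal y ∂ρ = ∫⁻ t in Ioi (0 : ℝ), ρ (Ioi t) := by
    intro ρ
    have := lintegral_eq_lintegral_meas_lt ρ (f := fun y : ℝ => max y 0)
      (Filter.Eventually.of_forall fun y => le_max_right _ _) (by fun_prop)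
    have e' : ∀ y : ℝ, ENNReal.ofReal (max y 0) = ENNReal.ofReal y := fun y => by
      rw [ENNReal.ofReal_max, ENNReal.ofReal_zero, max_eq_left zero_le]
    simp only [e'] at this
    rw [this]
    refine setLIntegral_congr_fun measurableSet_Ioi fun t ht => ?_
    congr 1
    ext y
    have ht' : ¬ t < 0 := not_lt.2 (le_of_lt ht)
    simp [ht']
  rw [e, e]
  exact lintegral_mono fun t => h t

/-- If `Y` is conditionally stochastically decreasing given a single parameter `θ`, its mean given
that `θ` lies in a leaf interval decreases from one leaf interval to the next ones. -/
lemma CondStochDecreasing.leafCell_le {L : ℕ} {a : Fin (2 ^ L + 1) → ℝ} (ha : StrictMono a)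
    {Ω : Type*} [MeasurableSpace Ω] {P : Measure Ω} {Y : Ω → ℝ} {θ : Ω → Fin 1 → ℝ}
    [SFinite (P.map θ)] (h : CondStochDecreasing P Y θ (thetaRange 1 a)) {c d : Fin (2 ^ L)}
    (hcd : c < d) :
    (∫⁻ ω, (leafEvent a d).indicator (fun _ => ENNReal.ofReal (Y ω)) (θ ω) ∂P)
        * ∫⁻ ω, (leafEvent a c).indicator (fun _ => 1) (θ ω) ∂P ≤
      (∫⁻ ω, (leafEvent a c).indicator
          (fun _ => ENNReal.ofReal (Y ω)) (θ ω) ∂P)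
        * ∫⁻ ω, (leafEvent a d).indicator (fun _ => 1) (θ ω) ∂P := by
  obtain ⟨κ, hκ, hcond, hmono⟩ := h
  have hθ : AEMeasurable θ P := hcond.aemeasurable.fst
  set M : (Fin 1 → ℝ) → ℝ≥0∞ := fun t => ∫⁻ y, ENNReal.ofReal y ∂κ t with hM
  have hMm : Measurable M := ENNReal.measurable_ofReal.lintegral_kernel
  have hE : ∀ c, ∫⁻ ω, (leafEvent a c).indicator
      (fun _ => ENNReal.ofReal (Y ω)) (θ ω) ∂P =
        ∫⁻ t in leafEvent a c, M t ∂P.map θ := by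
    intro c
    have hcell := measurableSet_leafEvent a c
    have hm : Measurable fun z : (Fin 1 → ℝ) × ℝ => (leafEvent a c).indicator
        (fun _ => ENNReal.ofReal z.2) z.1 :=
      (ENNReal.measurable_ofReal.comp measurable_snd).indicator (measurable_fst hcell)
    rw [← lintegral_map' (f := fun z : (Fin 1 → ℝ) × ℝ =>
      (leafEvent a c).indicator (fun _ => ENNReal.ofReal z.2) z.1)
      hm.aemeasurable hcond.aemeasurable, hcond.map_eq, Measure.lintegral_compProd hm,
      ← lintegral_indicator hcell]
    refine lintegral_congr fun t => ?_
    by_cases ht : t ∈ leafEvent a c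
    · simp only [indicator_of_mem ht, hM]
    · simp only [indicator_of_notMem ht, lintegral_zero]
  have hp : ∀ c, ∫⁻ ω, (leafEvent a c).indicator (fun _ => 1) (θ ω) ∂P =
      P.map θ (leafEvent a c) := by
    intro c
    have hcell := measurableSet_leafEvent a c
    rw [← lintegral_indicator_one hcell,
      lintegral_map' (measurable_one.indicator hcell).aemeasurable hθ]
    rfl
  have hrange : ∀ c (t : Fin 1 → ℝ), t 0 ∈ leafCell a c → t ∈ thetaRange 1 a := by
    intro c t ht k
    rw [Subsingleton.elim k 0]
    exact ⟨(ha.monotone (Fin.zero_le _)).trans_lt ht.1, ht.2.trans (ha.monotone (Fin.le_last _))⟩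
  rw [hE, hE, hp, hp]
  calc (∫⁻ t in leafEvent a d, M t ∂P.map θ) * P.map θ (leafEvent a c)
      = ∫⁻ t in leafEvent a d, ∫⁻ _ in leafEvent a c, M t ∂P.map θ ∂P.map θ := by
        rw [← lintegral_mul_const _ hMm]
        simp_rw [setLIntegral_const]
    _ ≤ ∫⁻ _ in leafEvent a d, ∫⁻ s in leafEvent a c, M s ∂P.map θ ∂P.map θ := by
        refine setLIntegral_mono' (measurableSet_leafEvent a d) fun t ht =>
          setLIntegral_mono' (measurableSet_leafEvent a c) fun s hs => ?_
        refine (hmono s (hrange c s hs) t (hrange d t ht) fun k => ?_).lintegral_ofReal_le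
        rw [Subsingleton.elim k 0]
        refine hs.2.trans (le_trans (ha.monotone ?_) ht.1.le)
        rw [Fin.le_def, Fin.val_succ, Fin.val_castSucc]
        exact hcd
    _ = _ := setLIntegral_const _ _

lemma beta_add_one_left {a b : ℝ} (ha : 0 < a) (hb : 0 < b) :
    beta (a + 1) b = a / (a + b) * beta a b := by
  have h := (Real.Gamma_pos_of_pos (add_pos ha hb)).ne'
  have h' := (add_pos ha hb).ne'
  rw [beta, beta, Real.Gamma_add_one ha.ne', show a + 1 + b = a + b + 1 by ring,
    Real.Gamma_add_one h']
  field_simp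

lemma beta_add_one_right {a b : ℝ} (ha : 0 < a) (hb : 0 < b) :
    beta a (b + 1) = b / (a + b) * beta a b := by
  have h := (Real.Gamma_pos_of_pos (add_pos ha hb)).ne'
  have h' := (add_pos ha hb).ne'
  rw [beta, beta, Real.Gamma_add_one hb.ne', ← add_assoc, Real.Gamma_add_one h']
  field_simp

/-- Moments of leaf probabilities, as products over the splits of ratios of Beta functions. -/
lemma lintegral_prod_leafProb {L K : ℕ} {α β : Split L → ℝ} (hα : ∀ s, 0 < α s)
    (hβ : ∀ s, 0 < β s) (i : Fin K → Fin (2 ^ L)) :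
    ∫⁻ φ, ∏ k, ENNReal.ofReal (leafProb φ (i k)) ∂Measure.pi (fun s => betaMeasure (α s) (β s)) =
      ENNReal.ofReal (∏ s, beta (α s + leftCount i s) (β s + rightCount i s) /
        beta (α s) (β s)) := by
  have hα' : ∀ s, 0 < α s + leftCount i s := fun s =>
    add_pos_of_pos_of_nonneg (hα s) (by positivity)
  have hβ' : ∀ s, 0 < β s + rightCount i s := fun s =>
    add_pos_of_pos_of_nonneg (hβ s) (by positivity)
  have : ∀ s, IsProbabilityMeasure
      (betaMeasure (α s + leftCount i s) (β s + rightCount i s)) := fun s =>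
    isProbabilityMeasureBeta (hα' s) (hβ' s)
  have key := lintegral_pi_betaMeasure_leafProb hα hβ i (G := fun _ => 1) measurable_const
  simp only [mul_one, lintegral_one, measure_univ] at key
  rw [key, ENNReal.ofReal_prod_of_nonneg]
  exact fun s _ => (div_pos (beta_pos (hα' s) (hβ' s)) (beta_pos (hα s) (hβ s))).le

lemma prod_split_two {M : Type*} [CommMonoid M] (f : Split 2 → M) :
    ∏ s, f s = f ⟨0, ⟨0, by decide⟩⟩ * (f ⟨1, ⟨0, by decide⟩⟩ * f ⟨1, ⟨1, by decide⟩⟩) := by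
  rw [Fintype.prod_sigma, Fin.prod_univ_two]
  congr 1
  · exact Fin.prod_univ_one (fun i : Fin 1 => f ⟨0, i⟩)
  · exact Fin.prod_univ_two (fun i : Fin 2 => f ⟨1, i⟩)

/-- With a `Beta(A, A)` prior, `A > 2`, at the root and uniform priors below it, an observation
in the second of four leaves gives the first leaf a smaller posterior mean than an observation in
the third leaf does. -/
lemma not_condStochDecreasing {a : Fin (2 ^ 2 + 1) → ℝ} (ha : StrictMono a) {m : Fin 1 → ℕ}
    {Ω : Type*} [MeasurableSpace Ω] {P : Measure Ω} {π : Ω → Fin (2 ^ 2) → ℝ}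
    {θ : Ω → Fin 1 → ℝ} {X : Ω → Fin 1 → ℕ} {A : ℝ} (hA : 2 < A)
    (hlaw : HasLaw (fun ω => (π ω, θ ω, X ω))
      (generativeModel a (fun s => if (s.1 : ℕ) = 0 then A else 1)
        (fun s => if (s.1 : ℕ) = 0 then A else 1) m) P) :
    ¬ CondStochDecreasing P (fun ω => mixingCDF a (π ω) (a 1)) θ (thetaRange 1 a) := by
  intro h
  have hpos : ∀ s : Split 2, 0 < if (s.1 : ℕ) = 0 then A else 1 := by
    intro s
    split_ifs <;> linarith
  have := sfinite_map_of_hasLaw_generativeModel hpos hpos hlaw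
  have hY : ∀ p : Fin (2 ^ 2) → ℝ, mixingCDF a p (a 1) = p 0 := by
    intro p
    rw [mixingCDF_apply_endpoint a ha, Finset.sum_eq_single 0]
    · simp
    · intro i _ hi
      rw [if_neg]
      intro hlt
      exact hi (Fin.ext (by simpa using hlt))
    · simp
  have key := h.leafCell_le ha (c := 1) (d := 2) (by decide)
  simp only [hY] at key
  rw [lintegral_hasLaw_leafCell ha hpos hpos hlaw (g := fun p => ENNReal.ofReal (p 0)) 1
      (by fun_prop),
    lintegral_hasLaw_leafCell ha hpos hpos hlaw (g := fun p => ENNReal.ofReal (p 0)) 2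
      (by fun_prop),
    lintegral_hasLaw_leafCell ha hpos hpos hlaw (g := fun _ => 1) 1 (by fun_prop),
    lintegral_hasLaw_leafCell ha hpos hpos hlaw (g := fun _ => 1) 2 (by fun_prop)] at key
  have e₂ := fun c d : Fin (2 ^ 2) => lintegral_prod_leafProb hpos hpos ![c, d]
  have e₁ := fun c : Fin (2 ^ 2) => lintegral_prod_leafProb hpos hpos ![c]
  simp only [Fin.prod_univ_two, Fin.prod_univ_one, Matrix.cons_val_zero, Matrix.cons_val_one,
    Matrix.cons_val_fin_one] at e₁ e₂
  simp only [mul_one, e₁, e₂, prod_split_two] at key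
  simp only [leftCount, rightCount, Finset.card_filter, Fin.sum_univ_two, Fin.sum_univ_one] at key
  norm_num at key
  have hA0 : 0 < A := by linarith
  have hB := beta_pos hA0 hA0
  have h1 := beta_pos one_pos one_pos
  have b₂₁ : beta 2 1 / beta 1 1 = 1 / 2 := by
    rw [show (2 : ℝ) = 1 + 1 by norm_num, beta_add_one_left one_pos one_pos, mul_div_assoc,
      div_self h1.ne', mul_one]
  have b₁₂ : beta 1 2 / beta 1 1 = 1 / 2 := by
    rw [show (2 : ℝ) = 1 + 1 by norm_num, beta_add_one_right one_pos one_pos, mul_div_assoc,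
      div_self h1.ne', mul_one]
  have b₂₂ : beta 2 2 / beta 1 1 = 1 / 6 := by
    have e : beta 2 2 = 1 / (2 + 1) * beta 2 1 := by
      have := beta_add_one_right (a := 2) (b := 1) two_pos one_pos
      rwa [one_add_one_eq_two] at this
    rw [e, mul_div_assoc, b₂₁]
    norm_num
  have c₁₀ : beta (A + 1) A / beta A A = 1 / 2 := by
    rw [beta_add_one_left hA0 hA0]
    field_simp
    norm_num
  have c₀₁ : beta A (A + 1) / beta A A = 1 / 2 := by
    rw [beta_add_one_right hA0 hA0]
    field_simp
    norm_num
  have c₁₁ : beta (A + 1) (A + 1) / beta A A = A / (2 * A + 1) * (1 / 2) := by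
    rw [beta_add_one_right (by linarith) hA0, mul_div_assoc, c₁₀]
    ring
  have c₂₀ : beta (A + 2) A / beta A A = (A + 1) / (2 * A + 1) * (1 / 2) := by
    rw [show A + 2 = A + 1 + 1 by ring, beta_add_one_left (by linarith) hA0, mul_div_assoc, c₁₀]
    ring
  rw [b₂₁, b₁₂, b₂₂, c₁₀, c₀₁, c₁₁, c₂₀, div_self h1.ne', ← ENNReal.ofReal_mul (by positivity),
    ← ENNReal.ofReal_mul (by positivity), ENNReal.ofReal_le_ofReal_iff (by positivity)] at key
  field_simp at key
  linarith

end FinitePolyaTree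

open FinitePolyaTree in
theorem mainTheorem2 :
    -- Beta(1,1) priors: monotonicity at every endpoint, for every depth and sample size
    (∀ (L K : ℕ) (a : Fin (2 ^ L + 1) → ℝ) (_ : StrictMono a) (m : Fin K → ℕ)
        {Ω : Type*} [MeasurableSpace Ω] (P : Measure Ω)
        (π : Ω → Fin (2 ^ L) → ℝ) (θ : Ω → Fin K → ℝ) (X : Ω → Fin K → ℕ)
        (_ : HasLaw (fun ω => (π ω, θ ω, X ω))
          (generativeModel a (fun _ => 1) (fun _ => 1) m) P)
        (j : Fin (2 ^ L + 1)),
        CondStochDecreasing P (fun ω => mixingCDF a (π ω) (a j)) θ (thetaRange K a)) ∧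
    -- the property fails for `L = 2`, `K = 1`, `φ_{1,1} ∼ Beta(10^6, 10^6)`,
    -- `φ_{2,1}, φ_{2,2} ∼ Beta(1, 1)`, at the endpoint `a_1`
    (∀ (a : Fin (2 ^ 2 + 1) → ℝ) (_ : StrictMono a) (m : Fin 1 → ℕ)
        {Ω : Type*} [MeasurableSpace Ω] (P : Measure Ω)
        (π : Ω → Fin (2 ^ 2) → ℝ) (θ : Ω → Fin 1 → ℝ) (X : Ω → Fin 1 → ℕ)
        (_ : HasLaw (fun ω => (π ω, θ ω, X ω))
          (generativeModel a (fun s => if (s.1 : ℕ) = 0 then 10 ^ 6 else 1)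
            (fun s => if (s.1 : ℕ) = 0 then 10 ^ 6 else 1) m) P),
        ¬ CondStochDecreasing P (fun ω => mixingCDF a (π ω) (a 1)) θ (thetaRange 1 a)) := by
  refine ⟨fun L K a ha m Ω _ P π θ X hlaw j => condStochDecreasing_of_uniform ha hlaw j,
    fun a ha m Ω _ P π θ X hlaw => not_condStochDecreasing ha (by norm_num) hlaw⟩
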